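/- Consider an M/M/1 queue with service rate $\mu$ and arrival rate $\lambda$, $0<\lambda<\mu$: customers arrive in a Poisson process of rate $\lambda$ and bring independent, exponentially distributed amounts of work with rate $\mu$, which a server processes at unit rate. The workload $W_t\in[0,\infty)$ is the amount of unfinished work at time $t$, that is, the time needed to empty the queue if no customer arrived after time $t$. For $0<\lambda'<\mu$ let $\pi(\lambda')$ be the stationary distribution of the workload process with arrival rate $\lambda'$ and service rate $\mu$, and let $W_t(\lambda_0,\lambda)$ denote the workload process with arrival rate $\lambda$ and service rate $\mu$ whose initial value has distribution $\pi(\lambda_0)$ (independently of the arrivals and of the service requirements). Let $\|P-Q\|_{\mathrm{TV}}=\sup_A|P(A)-Q(A)|$, the supremum being over the measurable sets. Suppose $0<\lambda_0\le\sqrt{\lambda\mu}$ and $\lambda_0\neq\lambda$. Then for every $\alpha>(\sqrt\mu-\sqrt\lambda)^2$, $$\limsup_{t\to\infty} e^{\alpha t}\,\bigl\|\mathcal L(W_t(\lambda_0,\lambda))-\pi(\lambda)\bigr\|_{\mathrm{TV}}=\infty .$$ Moreover, $(\sqrt\mu-\sqrt\lambda)^2$ is the best possible exponential rate of convergence: it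 is the largest $\alpha$ for which there is a constant $C$ with $\|\mathcal L(W_t(\lambda_0,\lambda))-\pi(\lambda)\|_{\mathrm{TV}}\le C e^{-\alpha t}$ for all $t\ge 0$. -/

import Mathlib

open MeasureTheory ProbabilityTheory Filter

namespace MM1

/-- The law of the input of a queue with arrival rate `lam` and service rate `mu`: i.i.d.
exponential interarrival times of rate `lam` (so that arrivals form a Poisson process) and,
independently, i.i.d. exponential service requirements of rate `mu`. -/
noncomputable def inputLaw (lam mu : ℝ) : Measure ((ℕ → ℝ) × (ℕ → ℝ)) :=
  (Measure.infinitePi fun _ : ℕ => expMeasure lam).prod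
    (Measure.infinitePi fun _ : ℕ => expMeasure mu)

/-- The time of the `n`-th arrival for the interarrival times `T`; `arrivalTime T 0 = 0` is the
starting time, not an arrival. -/
def arrivalTime (T : ℕ → ℝ) (n : ℕ) : ℝ := ∑ i ∈ Finset.range n, T i

/-- The number of arrivals up to time `t`: the first `n` such that the `(n + 1)`-st arrival
occurs after time `t`. -/
noncomputable def numArrivals (T : ℕ → ℝ) (t : ℝ) : ℕ := sInf {n : ℕ | t < arrivalTime T (n + 1)}

/-- The workload just after the `n`-th arrival. Between arrivals the workload decreases at unit
rate until it reaches zero; an arrival adds its service requirement. -/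
def workloadAtArrival (w : ℝ) (T S : ℕ → ℝ) : ℕ → ℝ
  | 0 => w
  | n + 1 => max (workloadAtArrival w T S n - T n) 0 + S n

/-- The workload at time `t`, when the workload at time `0` is `w`: the time needed to empty the
queue by serving only the work that is present at time `t`. -/
noncomputable def workload (w : ℝ) (T S : ℕ → ℝ) (t : ℝ) : ℝ :=
  max (workloadAtArrival w T S (numArrivals T t) - (t - arrivalTime T (numArrivals T t))) 0

/-- The law at time `t` of the workload process with arrival rate `lam`, service rate `mu` and
initial law `init`, the initial workload being independent of the input. -/
noncomputable def workloadLaw (lam mu : ℝ) (init : Measure ℝ) (t : ℝ) : Measure ℝ :=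
  (init.prod (inputLaw lam mu)).map fun p => workload p.1 p.2.1 p.2.2 t

/-- `ν` is a stationary distribution on `[0, ∞)` of the workload process with arrival rate `lam`
and service rate `mu`. -/
structure IsStationary (lam mu : ℝ) (ν : Measure ℝ) : Prop where
  prob : IsProbabilityMeasure ν
  nonneg : ν (Set.Iio 0) = 0
  invariant : ∀ t : ℝ, 0 ≤ t → workloadLaw lam mu ν t = ν

/-- Total variation distance between two probability measures: `sup_A |P(A) - Q(A)|`. -/
noncomputable def tvDist {Ω : Type*} [MeasurableSpace Ω] (P Q : Measure Ω) : ℝ :=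
  ⨆ A : {A : Set Ω // MeasurableSet A}, |P.real A - Q.real A|

lemma measurable_arrivalTime (n : ℕ) : Measurable fun T : ℕ → ℝ => arrivalTime T n := by
  unfold arrivalTime
  fun_prop

lemma measurable_numArrivals (t : ℝ) : Measurable fun T : ℕ → ℝ => numArrivals T t := by
  have hs : ∀ n, MeasurableSet {T : ℕ → ℝ | t < arrivalTime T (n + 1)} := fun n =>
    measurableSet_lt measurable_const (measurable_arrivalTime _)
  refine measurable_of_Iic fun k => ?_
  have : (fun T : ℕ → ℝ => numArrivals T t) ⁻¹' Set.Iic k =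
      (⋃ n ∈ Finset.range (k + 1), {T : ℕ → ℝ | t < arrivalTime T (n + 1)}) ∪
        ⋂ n, {T : ℕ → ℝ | t < arrivalTime T (n + 1)}ᶜ := by
    ext T
    simp only [Set.mem_preimage, Set.mem_Iic, Set.mem_union, Set.mem_iUnion, Set.mem_iInter,
      Set.mem_ofPred_eq, Set.mem_compl_iff, Finset.mem_range, exists_prop, numArrivals]
    constructor
    · intro h
      by_cases hne : {n : ℕ | t < arrivalTime T (n + 1)}.Nonempty
      · exact Or.inl ⟨_, Nat.lt_succ_of_le h, Nat.sInf_mem hne⟩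
      · exact Or.inr fun n hn => hne ⟨n, hn⟩
    · rintro (⟨n, hn, h⟩ | h)
      · exact (Nat.sInf_le h).trans (Nat.le_of_lt_succ hn)
      · have : {n : ℕ | t < arrivalTime T (n + 1)} = ∅ := by
          ext n
          simpa using h n
        simp [this]
  rw [this]
  exact (Finset.measurableSet_biUnion _ fun n _ => hs n).union
    (MeasurableSet.iInter fun n => (hs n).compl)

lemma measurable_workloadAtArrival (n : ℕ) :
    Measurable fun p : ℝ × (ℕ → ℝ) × (ℕ → ℝ) => workloadAtArrival p.1 p.2.1 p.2.2 n := by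
  induction n with
  | zero => exact measurable_fst
  | succ n ih =>
    simp only [workloadAtArrival]
    fun_prop

/-- The workload at a fixed time is a random variable. -/
lemma measurable_workload (t : ℝ) :
    Measurable fun p : ℝ × (ℕ → ℝ) × (ℕ → ℝ) => workload p.1 p.2.1 p.2.2 t := by
  have hN : Measurable fun p : ℝ × (ℕ → ℝ) × (ℕ → ℝ) => numArrivals p.2.1 t :=
    (measurable_numArrivals t).comp (by fun_prop)
  have hF : Measurable fun q : (ℝ × (ℕ → ℝ) × (ℕ → ℝ)) × ℕ =>
      max (workloadAtArrival q.1.1 q.1.2.1 q.1.2.2 q.2 - (t - arrivalTime q.1.2.1 q.2)) 0 := by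
    refine measurable_from_prod_countable_left fun n => ?_
    have h1 := measurable_workloadAtArrival n
    have h2 : Measurable fun p : ℝ × (ℕ → ℝ) × (ℕ → ℝ) => arrivalTime p.2.1 n :=
      (measurable_arrivalTime n).comp (by fun_prop)
    exact (h1.sub (measurable_const.sub h2)).max measurable_const
  exact hF.comp (measurable_id.prodMk hN)

end MM1

namespace MM1

open scoped ENNReal BoundedContinuousFunction

/-! Upper bound. Let `Y` be the net input up to time `t`, the work brought minus `t`. By the
reflection formula `workload_eq_max`, a queue started from `w ≥ 0` has workload `max W⁰ (w + Y)`,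
with `W⁰ ≥ 0` the workload of the initially empty queue fed by the same input. The two workloads can
differ only if `w + Y > 0`. If the initial law has tail at most `exp (-θ x)`, this has probability
at most `E exp (θ Y) = exp ((x + lam * mu / x - mu - lam) t)` with `x = mu - θ`. The exponent is
minimal at `x = √(lam * mu)`, with value `-(√mu - √lam)²`. The tail condition for `π₀` at this `θ`
is exactly where `lam₀ ≤ √(lam * mu)` is needed. Passing through the empty queue from both `π₀` and
`π` costs a factor 2.

Lower bound. It suffices to test the event that the queue is empty. Conditioning on the first
arrival gives `∫ exp (-φ(η) t) P(W_t = 0) dt = E exp (-η W_0) / η`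
(`lintegral_exp_mul_workloadLaw_zero`). Applied to a stationary law, this identifies it
(`IsStationary.eq_mixture`). Applied to `π₀`, it shows that the Laplace transform `F` of `P(W_t = 0)
- (mu - lam) / mu` satisfies, with `x = mu + η`, `F (x + lam * mu / x - mu - lam) = (lam - lam₀) x /
(mu (x - lam₀) (x - lam))` for `x > mu`. If the convergence had rate `a > (√mu - √lam)²`, then `F`
would be analytic on `(-a, ∞)`, which contains the argument of `F` for every `x > 0`. The identity
would continue to all of `(0, ∞)`, where the right side has a pole at `x = lam` because `lam₀ ≠
lam`. This contradiction is `not_abs_idle_sub_le`. -/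

/-! ### I.i.d. sequences and their first terms -/

/-- Prepend a term to a sequence. -/
def consSeq (r : ℝ) (T : ℕ → ℝ) : ℕ → ℝ
  | 0 => r
  | n + 1 => T n

@[simp] lemma consSeq_zero (r : ℝ) (T : ℕ → ℝ) : consSeq r T 0 = r := rfl

@[simp] lemma consSeq_succ (r : ℝ) (T : ℕ → ℝ) (n : ℕ) : consSeq r T (n + 1) = T n := rfl

lemma measurable_consSeq : Measurable fun p : ℝ × (ℕ → ℝ) => consSeq p.1 p.2 := by
  refine measurable_pi_lambda _ fun n => ?_
  cases n with
  | zero => exact measurable_fst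
  | succ n => exact (measurable_pi_apply n).comp measurable_snd

@[fun_prop]
lemma _root_.Measurable.consSeq {α : Type*} [MeasurableSpace α] {f : α → ℝ} {g : α → ℕ → ℝ}
    (hf : Measurable f) (hg : Measurable g) : Measurable fun x => consSeq (f x) (g x) :=
  measurable_consSeq.comp (hf.prodMk hg)

/-- An i.i.d. sequence is an independent first term followed by an i.i.d. sequence. -/
lemma map_consSeq_infinitePi (m : Measure ℝ) [IsProbabilityMeasure m] :
    (m.prod (Measure.infinitePi fun _ : ℕ => m)).map (fun p => consSeq p.1 p.2) =
      Measure.infinitePi fun _ : ℕ => m := by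
  refine Measure.eq_infinitePi _ fun s t ht => ?_
  rw [Measure.map_apply measurable_consSeq (.pi s.countable_toSet fun _ _ => ht _)]
  have : (fun p : ℝ × (ℕ → ℝ) => consSeq p.1 p.2) ⁻¹' (Set.pi s t) =
      (if 0 ∈ s then t 0 else Set.univ) ×ˢ
        Set.pi (s.preimage Nat.succ Nat.succ_injective.injOn : Finset ℕ) (fun n => t (n + 1)) := by
    ext ⟨r, T⟩
    simp only [Set.mem_preimage, Set.mem_pi, Set.mem_prod, Finset.mem_coe, Finset.mem_preimage]
    constructor
    · intro h
      refine ⟨?_, fun i hi => h _ hi⟩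
      split_ifs with h0
      · exact h 0 h0
      · trivial
    · rintro ⟨h0, h1⟩ i hi
      cases i with
      | zero => simpa [hi] using h0
      | succ i => exact h1 i hi
  rw [this, Measure.prod_prod, Measure.infinitePi_pi _ fun i _ => ht _]
  have himg : ∏ i ∈ s.preimage Nat.succ Nat.succ_injective.injOn, m (t (i + 1)) =
      ∏ i ∈ s.erase 0, m (t i) := by
    refine Finset.prod_bij (fun i _ => i + 1) ?_ ?_ ?_ ?_
    · intro i hi
      simpa using hi
    · intro i _ j _ h
      simpa using h
    · intro j hj
      obtain ⟨h1, h2⟩ := Finset.mem_erase.1 hj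
      obtain ⟨k, rfl⟩ := Nat.exists_eq_succ_of_ne_zero h1
      exact ⟨k, by simpa using h2, rfl⟩
    · intros
      rfl
  rw [himg]
  split_ifs with h0
  · exact Finset.mul_prod_erase s (fun i => m (t i)) h0
  · rw [measure_univ, one_mul, Finset.erase_eq_of_notMem h0]

lemma lintegral_infinitePi_consSeq (m : Measure ℝ) [IsProbabilityMeasure m]
    {f : (ℕ → ℝ) → ℝ≥0∞} (hf : Measurable f) :
    ∫⁻ T, f T ∂(Measure.infinitePi fun _ : ℕ => m) =
      ∫⁻ r, ∫⁻ T, f (consSeq r T) ∂(Measure.infinitePi fun _ : ℕ => m) ∂m := by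
  conv_lhs => rw [← map_consSeq_infinitePi m]
  rw [lintegral_map hf measurable_consSeq]
  exact lintegral_prod _ (hf.comp measurable_consSeq).aemeasurable

lemma isProbabilityMeasure_inputLaw {lam mu : ℝ} (hlam : 0 < lam) (hmu : 0 < mu) :
    IsProbabilityMeasure (inputLaw lam mu) := by
  have := isProbabilityMeasure_expMeasure hlam
  have := isProbabilityMeasure_expMeasure hmu
  unfold inputLaw
  infer_instance

/-- Conditioning on the first interarrival time and the first service requirement. -/
lemma lintegral_inputLaw_consSeq {lam mu : ℝ} (hlam : 0 < lam) (hmu : 0 < mu)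
    {f : (ℕ → ℝ) × (ℕ → ℝ) → ℝ≥0∞} (hf : Measurable f) :
    ∫⁻ q, f q ∂(inputLaw lam mu) =
      ∫⁻ r, ∫⁻ s, ∫⁻ q, f (consSeq r q.1, consSeq s q.2) ∂(inputLaw lam mu)
        ∂(expMeasure mu) ∂(expMeasure lam) := by
  have := isProbabilityMeasure_expMeasure hlam
  have := isProbabilityMeasure_expMeasure hmu
  have hT : Measurable fun p : (ℝ × (ℕ → ℝ)) × (ℕ → ℝ) => f (consSeq p.1.1 p.1.2, p.2) :=
    hf.comp (by fun_prop)
  have hTS : Measurable fun p : ((ℝ × (ℕ → ℝ)) × ℝ) × (ℕ → ℝ) =>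
      f (consSeq p.1.1.1 p.1.1.2, consSeq p.1.2 p.2) :=
    hf.comp (by fun_prop)
  unfold inputLaw
  rw [lintegral_prod _ hf.aemeasurable,
    lintegral_infinitePi_consSeq _ hf.lintegral_prod_right']
  refine lintegral_congr fun r => ?_
  have h1 : ∀ T : ℕ → ℝ, ∫⁻ S, f (consSeq r T, S) ∂(Measure.infinitePi fun _ : ℕ => expMeasure mu)
      = ∫⁻ s, ∫⁻ S, f (consSeq r T, consSeq s S) ∂(Measure.infinitePi fun _ : ℕ => expMeasure mu)
        ∂(expMeasure mu) := fun T =>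
    lintegral_infinitePi_consSeq _ (hf.comp (measurable_const.prodMk measurable_id))
  simp_rw [h1]
  have hm : Measurable fun p : (ℕ → ℝ) × ℝ => ∫⁻ S, f (consSeq r p.1, consSeq p.2 S)
      ∂(Measure.infinitePi fun _ : ℕ => expMeasure mu) := by
    have : Measurable fun p : ((ℕ → ℝ) × ℝ) × (ℕ → ℝ) =>
        f (consSeq r p.1.1, consSeq p.1.2 p.2) :=
      hf.comp (by fun_prop)
    exact this.lintegral_prod_right'
  -- The two splittings produce the order `r`, `T`, `s`, `S`; the swap brings both first terms
  -- outside.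
  rw [lintegral_lintegral_swap hm.aemeasurable]
  refine lintegral_congr fun s => ?_
  rw [lintegral_prod]
  exact (hf.comp (by fun_prop)).aemeasurable

/-! ### Integrals against the exponential distribution -/

lemma lintegral_expMeasure {r : ℝ} {f : ℝ → ℝ≥0∞} (hf : Measurable f) :
    ∫⁻ x, f x ∂(expMeasure r) =
      ∫⁻ x in Set.Ici 0, ENNReal.ofReal (r * Real.exp (-(r * x))) * f x := by
  have h : expMeasure r = volume.withDensity (exponentialPDF r) := rfl
  have hm : Measurable (exponentialPDF r) := (measurable_exponentialPDFReal r).ennreal_ofReal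
  rw [h, lintegral_withDensity_eq_lintegral_mul _ hm hf, ← lintegral_indicator measurableSet_Ici]
  refine lintegral_congr fun x => ?_
  by_cases hx : 0 ≤ x
  · simp [hx, exponentialPDF_of_nonneg hx]
  · simp [hx, exponentialPDF_of_neg (not_le.1 hx)]

lemma ae_expMeasure_nonneg (r : ℝ) : ∀ᵐ x ∂(expMeasure r), 0 ≤ x := by
  have : (expMeasure r) (Set.Iio 0) = 0 := by
    have h : expMeasure r = volume.withDensity (exponentialPDF r) := rfl
    rw [h, withDensity_apply _ measurableSet_Iio]
    exact lintegral_exponentialPDF_of_nonpos le_rfl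
  rw [ae_iff]
  simpa [Set.Iio, not_le] using this

/-- Integrating an exponential over a half-line. -/
lemma lintegral_exp_neg_Ici {c : ℝ} (hc : 0 < c) (a : ℝ) :
    ∫⁻ x in Set.Ici a, ENNReal.ofReal (Real.exp (-(c * x))) =
      ENNReal.ofReal (Real.exp (-(c * a)) / c) := by
  have h := integral_exp_mul_Ioi (a := -c) (by linarith) a
  have hi := integrableOn_exp_mul_Ioi (a := -c) (by linarith) a
  rw [setLIntegral_congr Ioi_ae_eq_Ici.symm]
  simp only [neg_mul] at h hi
  rw [← ofReal_integral_eq_lintegral_ofReal hi (ae_of_all _ fun x => (Real.exp_pos _).le), h,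
    neg_div_neg_eq]

/-- The Laplace transform of the exponential distribution. -/
lemma lintegral_exp_expMeasure {r c : ℝ} (hr : 0 < r) (hc : 0 < r + c) :
    ∫⁻ x, ENNReal.ofReal (Real.exp (-(c * x))) ∂(expMeasure r) = ENNReal.ofReal (r / (r + c)) := by
  rw [lintegral_expMeasure (by fun_prop)]
  have : ∀ x : ℝ, ENNReal.ofReal (r * Real.exp (-(r * x))) * ENNReal.ofReal (Real.exp (-(c * x))) =
      ENNReal.ofReal r * ENNReal.ofReal (Real.exp (-((r + c) * x))) := fun x => by
    rw [ENNReal.ofReal_mul hr.le, mul_assoc, ← ENNReal.ofReal_mul (Real.exp_pos _).le,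
      ← Real.exp_add]
    ring_nf
  simp_rw [this]
  rw [lintegral_const_mul _ (by fun_prop), lintegral_exp_neg_Ici hc, ← ENNReal.ofReal_mul hr.le]
  simp [div_eq_mul_inv]

/-- The tail of the exponential distribution. -/
lemma expMeasure_Ici {r a : ℝ} (hr : 0 < r) (ha : 0 ≤ a) :
    expMeasure r (Set.Ici a) = ENNReal.ofReal (Real.exp (-(r * a))) := by
  rw [← lintegral_indicator_one measurableSet_Ici,
    lintegral_expMeasure (measurable_one.indicator measurableSet_Ici)]
  have : ∀ x, ENNReal.ofReal (r * Real.exp (-(r * x))) * (Set.Ici a).indicator 1 x =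
      (Set.Ici a).indicator
        (fun x => ENNReal.ofReal r * ENNReal.ofReal (Real.exp (-(r * x)))) x := fun x => by
    by_cases hx : x ∈ Set.Ici a <;> simp [hx, ENNReal.ofReal_mul hr.le]
  simp_rw [this]
  rw [setLIntegral_indicator measurableSet_Ici, Set.Ici_inter_Ici, sup_eq_left.2 ha,
    lintegral_const_mul _ (by fun_prop), lintegral_exp_neg_Ici hr, ← ENNReal.ofReal_mul hr.le]
  congr 1
  field_simp

/-! ### Restarting at the first arrival, and the Poisson count of arrivals -/

lemma arrivalTime_consSeq (r : ℝ) (T : ℕ → ℝ) (n : ℕ) :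
    arrivalTime (consSeq r T) (n + 1) = r + arrivalTime T n := by
  simp [arrivalTime, Finset.sum_range_succ', add_comm]

lemma workloadAtArrival_consSeq (w r s : ℝ) (T S : ℕ → ℝ) (n : ℕ) :
    workloadAtArrival w (consSeq r T) (consSeq s S) (n + 1) =
      workloadAtArrival (max (w - r) 0 + s) T S n := by
  induction n with
  | zero => rfl
  | succ n ih => rw [workloadAtArrival, ih]; rfl

/-- Interarrival times for which exactly `n` arrivals have occurred by time `t`. -/
def countEvent (n : ℕ) (t : ℝ) : Set (ℕ → ℝ) := {T | arrivalTime T n ≤ t ∧ t < arrivalTime T (n + 1)}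

lemma measurableSet_countEvent (n : ℕ) (t : ℝ) : MeasurableSet (countEvent n t) :=
  (measurableSet_le (measurable_arrivalTime n) measurable_const).inter
    (measurableSet_lt measurable_const (measurable_arrivalTime _))

lemma consSeq_mem_countEvent_succ (r : ℝ) (T : ℕ → ℝ) (n : ℕ) (t : ℝ) :
    consSeq r T ∈ countEvent (n + 1) t ↔ T ∈ countEvent n (t - r) := by
  simp only [countEvent, Set.mem_ofPred_eq, arrivalTime_consSeq]
  constructor <;> rintro ⟨h1, h2⟩ <;> constructor <;> linarith

lemma consSeq_mem_countEvent_zero (r : ℝ) (T : ℕ → ℝ) (t : ℝ) :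
    consSeq r T ∈ countEvent 0 t ↔ 0 ≤ t ∧ t < r := by
  simp [countEvent, arrivalTime]

lemma expMeasure_Ioi {r a : ℝ} (hr : 0 < r) (ha : 0 ≤ a) :
    expMeasure r (Set.Ioi a) = ENNReal.ofReal (Real.exp (-(r * a))) := by
  have h : expMeasure r = volume.withDensity (exponentialPDF r) := rfl
  have : expMeasure r (Set.Ioi a) = expMeasure r (Set.Ici a) := by
    rw [h]
    exact measure_congr ((withDensity_absolutelyContinuous _ _).ae_eq Ioi_ae_eq_Ici)
  rw [this, expMeasure_Ici hr ha]

/-- The number of arrivals up to time `t` has a Poisson distribution. -/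
lemma infinitePi_countEvent {lam : ℝ} (hlam : 0 < lam) (n : ℕ) (t : ℝ) :
    (Measure.infinitePi fun _ : ℕ => expMeasure lam) (countEvent n t) =
      if 0 ≤ t then ENNReal.ofReal (Real.exp (-(lam * t)) * (lam * t) ^ n / n.factorial) else 0 := by
  have := isProbabilityMeasure_expMeasure hlam
  induction n generalizing t with
  | zero =>
    rw [← lintegral_indicator_one (measurableSet_countEvent _ _),
      lintegral_infinitePi_consSeq _ (measurable_one.indicator (measurableSet_countEvent _ _))]
    split_ifs with ht
    · have : ∀ r T, (countEvent 0 t).indicator (1 : (ℕ → ℝ) → ℝ≥0∞) (consSeq r T) =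
          (Set.Ioi t).indicator 1 r := fun r T => by
        by_cases h : t < r <;> simp [Set.indicator, consSeq_mem_countEvent_zero, ht, h]
      simp_rw [this]
      simp [expMeasure_Ioi hlam ht, lintegral_indicator_one measurableSet_Ioi]
    · simp [Set.indicator, consSeq_mem_countEvent_zero, ht]
  | succ n ih =>
    rw [← lintegral_indicator_one (measurableSet_countEvent _ _),
      lintegral_infinitePi_consSeq _ (measurable_one.indicator (measurableSet_countEvent _ _))]
    have h1 : ∀ r, ∫⁻ T, (countEvent (n + 1) t).indicator (1 : (ℕ → ℝ) → ℝ≥0∞) (consSeq r T)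
        ∂(Measure.infinitePi fun _ : ℕ => expMeasure lam) =
        if 0 ≤ t - r then ENNReal.ofReal
          (Real.exp (-(lam * (t - r))) * (lam * (t - r)) ^ n / n.factorial) else 0 := fun r => by
      rw [← ih, ← lintegral_indicator_one (measurableSet_countEvent _ _)]
      refine lintegral_congr fun T => ?_
      have := consSeq_mem_countEvent_succ r T n t
      by_cases h : T ∈ countEvent n (t - r)
      · rw [Set.indicator_of_mem h, Set.indicator_of_mem (this.2 h)]
        rfl
      · rw [Set.indicator_of_notMem h, Set.indicator_of_notMem (mt this.1 h)]
    simp_rw [h1]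
    rw [lintegral_expMeasure (Measurable.ite (measurableSet_le (by fun_prop) (by fun_prop))
      (by fun_prop) (by fun_prop))]
    -- The exponentials combine to `exp (-(lam * t))`, free of `r`; only `(t - r) ^ n` remains to be
    -- integrated over `[0, t]`, which supplies the new factor `t / (n + 1)`.
    have h2 : ∀ r, ENNReal.ofReal (lam * Real.exp (-(lam * r))) * (if 0 ≤ t - r then ENNReal.ofReal
          (Real.exp (-(lam * (t - r))) * (lam * (t - r)) ^ n / n.factorial) else 0) =
        (Set.Iic t).indicator (fun r => ENNReal.ofReal
          (Real.exp (-(lam * t)) * lam ^ (n + 1) / n.factorial * (t - r) ^ n)) r := fun r => by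
      by_cases h : r ≤ t
      · rw [if_pos (by linarith), Set.indicator_of_mem (by exact h),
          ← ENNReal.ofReal_mul (by positivity)]
        have : Real.exp (-(lam * t)) = Real.exp (-(lam * r)) * Real.exp (-(lam * (t - r))) := by
          rw [← Real.exp_add]
          ring_nf
        rw [this, mul_pow]
        ring_nf
      · rw [if_neg (by linarith), Set.indicator_of_notMem (by exact h), mul_zero]
    simp_rw [h2]
    rw [setLIntegral_indicator measurableSet_Iic, Set.inter_comm, Set.Ici_inter_Iic]
    split_ifs with ht
    · rw [setLIntegral_congr Ioc_ae_eq_Icc.symm, ← ofReal_integral_eq_lintegral_ofReal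
        ((by fun_prop : Continuous fun r : ℝ => Real.exp (-(lam * t)) * lam ^ (n + 1) / n.factorial *
          (t - r) ^ n).integrableOn_Ioc),
        ← intervalIntegral.integral_of_le ht, intervalIntegral.integral_const_mul,
        intervalIntegral.integral_comp_sub_left (fun x => x ^ n) t, integral_pow]
      · congr 1
        rw [Nat.factorial_succ]
        push_cast
        field_simp
        simp
        ring
      · refine (ae_restrict_mem measurableSet_Ioc).mono fun r hr => ?_
        have : 0 ≤ t - r := by linarith [hr.2]
        simp only [Pi.zero_apply]
        positivity
    · rw [Set.Icc_eq_empty ht]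
      simp

/-- Nonnegative interarrival times make the arrival times monotone, so no earlier index can already
lie beyond `t`. -/
lemma numArrivals_eq {T : ℕ → ℝ} (hT : ∀ i, 0 ≤ T i) {n : ℕ} {t : ℝ} (h : T ∈ countEvent n t) :
    numArrivals T t = n := by
  refine le_antisymm (Nat.sInf_le h.2) (le_csInf ⟨n, h.2⟩ fun m (hm : t < arrivalTime T (m + 1)) => ?_)
  by_contra! hlt
  have : arrivalTime T (m + 1) ≤ arrivalTime T n :=
    Finset.sum_le_sum_of_subset_of_nonneg (Finset.range_subset_range.2 hlt) fun i _ _ => hT i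
  linarith [h.1]

lemma ae_forall_nonneg {lam : ℝ} (hlam : 0 < lam) :
    ∀ᵐ T ∂(Measure.infinitePi fun _ : ℕ => expMeasure lam), ∀ i, 0 ≤ T i := by
  have := isProbabilityMeasure_expMeasure hlam
  refine ae_all_iff.2 fun i => ?_
  exact (measurePreserving_eval_infinitePi (fun _ : ℕ => expMeasure lam) i).quasiMeasurePreserving.ae
    (ae_expMeasure_nonneg lam)

/-- Almost surely only finitely many customers arrive up to time `t`. -/
lemma ae_exists_mem_countEvent {lam t : ℝ} (hlam : 0 < lam) (ht : 0 ≤ t) :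
    ∀ᵐ T ∂(Measure.infinitePi fun _ : ℕ => expMeasure lam), ∃ n, T ∈ countEvent n t := by
  have := isProbabilityMeasure_expMeasure hlam
  set P := Measure.infinitePi fun _ : ℕ => expMeasure lam
  -- Disjointness holds only almost surely: sequences with negative terms may lie in several count
  -- events.
  have hdisj : Pairwise (Function.onFun (AEDisjoint P) fun n => countEvent n t) := by
    intro m n hmn
    refine measure_mono_null ?_ (ae_iff.1 (ae_forall_nonneg hlam))
    rintro T ⟨hm, hn⟩ hT
    exact hmn ((numArrivals_eq hT hm).symm.trans (numArrivals_eq hT hn))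
  have h1 : P (⋃ n, countEvent n t) = 1 := by
    rw [measure_iUnion₀ hdisj fun n => (measurableSet_countEvent n t).nullMeasurableSet]
    simp_rw [P, infinitePi_countEvent hlam, if_pos ht]
    have hs := (NormedSpace.expSeries_div_hasSum_exp (𝔸 := ℝ) (lam * t)).mul_left
      (Real.exp (-(lam * t)))
    rw [← Real.exp_eq_exp_ℝ, ← Real.exp_add, neg_add_cancel, Real.exp_zero] at hs
    simp_rw [← mul_div_assoc] at hs
    rw [← ENNReal.ofReal_tsum_of_nonneg (fun n => by positivity) hs.summable, hs.tsum_eq,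
      ENNReal.ofReal_one]
  have h2 := (prob_compl_eq_zero_iff (.iUnion fun n => measurableSet_countEvent n t)).2 h1
  rw [ae_iff]
  convert h2 using 2
  ext T
  simp

/-- Decomposition of an expectation according to the number of arrivals up to time `t`. -/
lemma lintegral_numArrivals {lam mu t : ℝ} (hlam : 0 < lam) (hmu : 0 < mu) (ht : 0 ≤ t)
    {F : ℕ → (ℕ → ℝ) × (ℕ → ℝ) → ℝ≥0∞} (hF : ∀ n, Measurable (F n)) :
    ∫⁻ q, F (numArrivals q.1 t) q ∂(inputLaw lam mu) =
      ∑' n, ∫⁻ q, (countEvent n t).indicator 1 q.1 * F n q ∂(inputLaw lam mu) := by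
  have := isProbabilityMeasure_expMeasure hlam
  have := isProbabilityMeasure_expMeasure hmu
  have hm : ∀ n, Measurable fun q : (ℕ → ℝ) × (ℕ → ℝ) =>
      (countEvent n t).indicator (1 : (ℕ → ℝ) → ℝ≥0∞) q.1 * F n q := fun n =>
    ((measurable_one.indicator (measurableSet_countEvent n t)).comp measurable_fst).mul (hF n)
  rw [← lintegral_tsum fun n => (hm n).aemeasurable]
  refine lintegral_congr_ae ?_
  have hae : ∀ᵐ q ∂(inputLaw lam mu), (∀ i, 0 ≤ q.1 i) ∧ ∃ n, q.1 ∈ countEvent n t :=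
    Measure.quasiMeasurePreserving_fst.ae
      ((ae_forall_nonneg hlam).and (ae_exists_mem_countEvent hlam ht))
  filter_upwards [hae] with q ⟨hq, n, hn⟩
  rw [tsum_eq_single n, Set.indicator_of_mem hn, numArrivals_eq hq hn, Pi.one_apply, one_mul]
  intro m hm
  rw [Set.indicator_of_notMem, zero_mul]
  exact fun h => hm ((numArrivals_eq hq h).symm.trans (numArrivals_eq hq hn))

/-! ### Exponential moments of the net input -/

lemma lintegral_exp_sum {mu th : ℝ} (hmu : 0 < mu) (hth : th < mu) (n : ℕ) :
    ∫⁻ S, ENNReal.ofReal (Real.exp (th * ∑ i ∈ Finset.range n, S i))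
      ∂(Measure.infinitePi fun _ : ℕ => expMeasure mu) = ENNReal.ofReal ((mu / (mu - th)) ^ n) := by
  have := isProbabilityMeasure_expMeasure hmu
  have hz : 0 ≤ mu / (mu - th) := div_nonneg hmu.le (by linarith)
  induction n with
  | zero => simp
  | succ n ih =>
    rw [lintegral_infinitePi_consSeq _ (by fun_prop)]
    have : ∀ s S, ENNReal.ofReal (Real.exp (th * ∑ i ∈ Finset.range (n + 1), consSeq s S i)) =
        ENNReal.ofReal (Real.exp (-(-th * s))) *
          ENNReal.ofReal (Real.exp (th * ∑ i ∈ Finset.range n, S i)) := fun s S => by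
      rw [← ENNReal.ofReal_mul (Real.exp_pos _).le, ← Real.exp_add, Finset.sum_range_succ']
      simp only [consSeq_succ, consSeq_zero]
      ring_nf
    simp_rw [this]
    simp_rw [lintegral_const_mul _ (by fun_prop : Measurable fun S : ℕ → ℝ => ENNReal.ofReal
      (Real.exp (th * ∑ i ∈ Finset.range n, S i))), ih]
    rw [lintegral_mul_const _ (by fun_prop), lintegral_exp_expMeasure hmu (by linarith),
      ← ENNReal.ofReal_mul (div_nonneg hmu.le (by linarith)), pow_succ', sub_eq_add_neg]

/-- The exponential moments of the net input up to time `t`. -/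
lemma lintegral_exp_netInput {lam mu th t : ℝ} (hlam : 0 < lam) (hmu : 0 < mu) (hth : th < mu)
    (ht : 0 ≤ t) :
    ∫⁻ q, ENNReal.ofReal (Real.exp (th * (∑ i ∈ Finset.range (numArrivals q.1 t), q.2 i - t)))
      ∂(inputLaw lam mu) =
      ENNReal.ofReal (Real.exp ((lam * (mu / (mu - th)) - lam - th) * t)) := by
  have := isProbabilityMeasure_expMeasure hlam
  have := isProbabilityMeasure_expMeasure hmu
  rw [lintegral_numArrivals hlam hmu ht (F := fun n q => ENNReal.ofReal
    (Real.exp (th * (∑ i ∈ Finset.range n, q.2 i - t)))) fun n => by fun_prop]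
  set z := mu / (mu - th) with hz
  have hz0 : 0 ≤ z := div_nonneg hmu.le (by linarith)
  have h1 : ∀ n, ∫⁻ q, (countEvent n t).indicator 1 q.1 * ENNReal.ofReal
      (Real.exp (th * (∑ i ∈ Finset.range n, q.2 i - t))) ∂(inputLaw lam mu) =
      ENNReal.ofReal (Real.exp (-(th * t)) * Real.exp (-(lam * t)) *
        ((lam * z * t) ^ n / n.factorial)) := fun n => by
    have : ∀ S : ℕ → ℝ, ENNReal.ofReal (Real.exp (th * (∑ i ∈ Finset.range n, S i - t))) =
        ENNReal.ofReal (Real.exp (-(th * t))) *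
          ENNReal.ofReal (Real.exp (th * ∑ i ∈ Finset.range n, S i)) := fun S => by
      rw [← ENNReal.ofReal_mul (Real.exp_pos _).le, ← Real.exp_add]
      ring_nf
    simp_rw [this]
    unfold inputLaw
    rw [lintegral_prod_mul (g := fun S : ℕ → ℝ => ENNReal.ofReal (Real.exp (-(th * t))) *
        ENNReal.ofReal (Real.exp (th * ∑ i ∈ Finset.range n, S i)))
      (measurable_one.indicator (measurableSet_countEvent n t)).aemeasurable (by fun_prop), lintegral_indicator_one (measurableSet_countEvent n t),
      lintegral_const_mul _ (by fun_prop), lintegral_exp_sum hmu hth,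
      infinitePi_countEvent hlam, if_pos ht, ← ENNReal.ofReal_mul (Real.exp_pos _).le,
      ← ENNReal.ofReal_mul (by positivity)]
    congr 1
    rw [← hz]
    ring
  simp_rw [h1]
  -- This is the Poisson generating function at `z`, the exponential moment of a single service
  -- requirement.
  have hs := (NormedSpace.expSeries_div_hasSum_exp (𝔸 := ℝ) (lam * z * t)).mul_left
      (Real.exp (-(th * t)) * Real.exp (-(lam * t)))
  rw [← Real.exp_eq_exp_ℝ, ← Real.exp_add, ← Real.exp_add] at hs
  rw [← ENNReal.ofReal_tsum_of_nonneg (fun n => by positivity) (by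
    simpa only [← Real.exp_add] using hs.summable)]
  simp_rw [← Real.exp_add]
  rw [hs.tsum_eq]
  ring_nf

/-! ### Laplace transform of the probability of an empty queue -/

/-- Inputs for which exactly `n` arrivals have occurred by time `t` and the queue, started with
workload `w`, is empty at time `t`. -/
def idleEvent (n : ℕ) (w t : ℝ) : Set ((ℕ → ℝ) × (ℕ → ℝ)) :=
  {q | q.1 ∈ countEvent n t ∧ workloadAtArrival w q.1 q.2 n ≤ t - arrivalTime q.1 n}

lemma consSeq_mem_idleEvent_succ (r s w t : ℝ) (q : (ℕ → ℝ) × (ℕ → ℝ)) (n : ℕ) :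
    (consSeq r q.1, consSeq s q.2) ∈ idleEvent (n + 1) w t ↔
      q ∈ idleEvent n (max (w - r) 0 + s) (t - r) := by
  simp only [idleEvent, Set.mem_ofPred_eq, consSeq_mem_countEvent_succ, arrivalTime_consSeq,
    workloadAtArrival_consSeq, sub_sub]

lemma measurableSet_idleEvent_prod (n : ℕ) :
    MeasurableSet {x : (ℝ × ℝ) × ((ℕ → ℝ) × (ℕ → ℝ)) | x.2 ∈ idleEvent n x.1.1 x.1.2} := by
  have hV : Measurable fun x : (ℝ × ℝ) × ((ℕ → ℝ) × (ℕ → ℝ)) =>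
      workloadAtArrival x.1.1 x.2.1 x.2.2 n :=
    (measurable_workloadAtArrival n).comp
      (by fun_prop : Measurable fun x : (ℝ × ℝ) × ((ℕ → ℝ) × (ℕ → ℝ)) => (x.1.1, x.2.1, x.2.2))
  have hA : ∀ m, Measurable fun x : (ℝ × ℝ) × ((ℕ → ℝ) × (ℕ → ℝ)) => arrivalTime x.2.1 m :=
    fun m => (measurable_arrivalTime m).comp (by fun_prop)
  have ht : Measurable fun x : (ℝ × ℝ) × ((ℕ → ℝ) × (ℕ → ℝ)) => x.1.2 := by fun_prop
  exact ((measurableSet_le (hA n) ht).inter (measurableSet_lt ht (hA (n + 1)))).inter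
    (measurableSet_le hV (ht.sub (hA n)))

lemma measurableSet_idleEvent (n : ℕ) (w t : ℝ) : MeasurableSet (idleEvent n w t) :=
  measurable_prodMk_left (x := (w, t)) (measurableSet_idleEvent_prod n)

/-- The probability that exactly `n` arrivals have occurred by time `t` and the queue, started with
workload `w`, is empty at time `t`. -/
noncomputable def idleProb (lam mu : ℝ) (n : ℕ) (w t : ℝ) : ℝ≥0∞ :=
  inputLaw lam mu (idleEvent n w t)

lemma measurable_idleProb {lam mu : ℝ} (hlam : 0 < lam) (hmu : 0 < mu) (n : ℕ) :
    Measurable fun p : ℝ × ℝ => idleProb lam mu n p.1 p.2 := by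
  have := isProbabilityMeasure_inputLaw hlam hmu
  exact measurable_measure_prodMk_left (measurableSet_idleEvent_prod n)

@[fun_prop]
lemma measurable_idleProb_comp {lam mu : ℝ} (hlam : 0 < lam) (hmu : 0 < mu) (n : ℕ)
    {α : Type*} [MeasurableSpace α] {f g : α → ℝ} (hf : Measurable f) (hg : Measurable g) :
    Measurable fun x => idleProb lam mu n (f x) (g x) :=
  (measurable_idleProb hlam hmu n).comp (hf.prodMk hg)

/-- The queue starts afresh just after its first arrival. The remaining time `t - r` may be
negative; those `r` contribute nothing, by `idleProb_of_neg`. -/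
lemma idleProb_succ {lam mu : ℝ} (hlam : 0 < lam) (hmu : 0 < mu) (n : ℕ) (w t : ℝ) :
    idleProb lam mu (n + 1) w t = ∫⁻ r, ∫⁻ s, idleProb lam mu n (max (w - r) 0 + s) (t - r)
      ∂(expMeasure mu) ∂(expMeasure lam) := by
  have h := measurableSet_idleEvent (n + 1) w t
  rw [idleProb, ← lintegral_indicator_one h,
    lintegral_inputLaw_consSeq hlam hmu (measurable_one.indicator h)]
  refine lintegral_congr fun r => lintegral_congr fun s => ?_
  rw [idleProb, ← lintegral_indicator_one (measurableSet_idleEvent _ _ _)]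
  refine lintegral_congr fun q => ?_
  have := consSeq_mem_idleEvent_succ r s w t q n
  by_cases h : q ∈ idleEvent n (max (w - r) 0 + s) (t - r)
  · rw [Set.indicator_of_mem h, Set.indicator_of_mem (this.2 h)]
    rfl
  · rw [Set.indicator_of_notMem h, Set.indicator_of_notMem (mt this.1 h)]

lemma inputLaw_fst_mem {lam mu : ℝ} (hlam : 0 < lam) (hmu : 0 < mu) (A : Set (ℕ → ℝ)) :
    inputLaw lam mu {q | q.1 ∈ A} = (Measure.infinitePi fun _ : ℕ => expMeasure lam) A := by
  have := isProbabilityMeasure_expMeasure hlam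
  have := isProbabilityMeasure_expMeasure hmu
  have : {q : (ℕ → ℝ) × (ℕ → ℝ) | q.1 ∈ A} = A ×ˢ Set.univ := by
    ext
    simp
  rw [this, inputLaw, Measure.prod_prod, measure_univ, mul_one]

lemma idleProb_of_neg {lam mu : ℝ} (hlam : 0 < lam) (hmu : 0 < mu) (n : ℕ) (w : ℝ) {t : ℝ}
    (ht : t < 0) : idleProb lam mu n w t = 0 := by
  refine measure_mono_null (t := {q | q.1 ∈ countEvent n t}) (fun q hq => hq.1) ?_
  rw [inputLaw_fst_mem hlam hmu, infinitePi_countEvent hlam, if_neg (not_le.2 ht)]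

lemma idleProb_zero {lam mu : ℝ} (hlam : 0 < lam) (hmu : 0 < mu) {w : ℝ} (hw : 0 ≤ w) (t : ℝ) :
    idleProb lam mu 0 w t =
      (Set.Ici w).indicator (fun t => ENNReal.ofReal (Real.exp (-(lam * t)))) t := by
  by_cases h : w ≤ t
  · have : idleEvent 0 w t = {q | q.1 ∈ countEvent 0 t} := by
      ext q
      simp [idleEvent, workloadAtArrival, arrivalTime, h]
    rw [idleProb, this, inputLaw_fst_mem hlam hmu, infinitePi_countEvent hlam,
      if_pos (hw.trans h), Set.indicator_of_mem (by exact h)]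
    simp
  · have : idleEvent 0 w t = ∅ := by
      ext q
      simp [idleEvent, workloadAtArrival, arrivalTime, not_le.1 h]
    rw [idleProb, this, measure_empty, Set.indicator_of_notMem (by exact h)]

/-- The Laplace transform in time of `idleProb`. -/
noncomputable def idleLaplace (lam mu b : ℝ) (n : ℕ) (w : ℝ) : ℝ≥0∞ :=
  ∫⁻ t, ENNReal.ofReal (Real.exp (-(b * t))) * idleProb lam mu n w t

lemma measurable_idleLaplace {lam mu : ℝ} (hlam : 0 < lam) (hmu : 0 < mu) (b : ℝ) (n : ℕ) :
    Measurable (idleLaplace lam mu b n) := by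
  have : Measurable fun p : ℝ × ℝ =>
      ENNReal.ofReal (Real.exp (-(b * p.2))) * idleProb lam mu n p.1 p.2 :=
    Measurable.mul (by fun_prop) (measurable_idleProb hlam hmu n)
  exact this.lintegral_prod_right'

lemma idleLaplace_zero {lam mu b w : ℝ} (hlam : 0 < lam) (hmu : 0 < mu) (hb : 0 < lam + b)
    (hw : 0 ≤ w) :
    idleLaplace lam mu b 0 w = ENNReal.ofReal (Real.exp (-((lam + b) * w)) / (lam + b)) := by
  unfold idleLaplace
  rw [← lintegral_exp_neg_Ici hb, ← lintegral_indicator measurableSet_Ici]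
  refine lintegral_congr fun t => ?_
  rw [idleProb_zero hlam hmu hw]
  by_cases h : t ∈ Set.Ici w
  · rw [Set.indicator_of_mem h, Set.indicator_of_mem h, ← ENNReal.ofReal_mul (Real.exp_pos _).le,
      ← Real.exp_add]
    ring_nf
  · rw [Set.indicator_of_notMem h, Set.indicator_of_notMem h, mul_zero]

lemma idleLaplace_succ {lam mu : ℝ} (hlam : 0 < lam) (hmu : 0 < mu) (b : ℝ) (n : ℕ) (w : ℝ) :
    idleLaplace lam mu b (n + 1) w = ∫⁻ r, ENNReal.ofReal (Real.exp (-(b * r))) *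
      ∫⁻ s, idleLaplace lam mu b n (max (w - r) 0 + s) ∂(expMeasure mu) ∂(expMeasure lam) := by
  have := isProbabilityMeasure_expMeasure hlam
  have := isProbabilityMeasure_expMeasure hmu
  have hm : Measurable fun p : (ℝ × ℝ) × ℝ =>
      idleProb lam mu n (max (w - p.1.2) 0 + p.2) (p.1.1 - p.1.2) :=
    measurable_idleProb_comp hlam hmu n (by fun_prop) (by fun_prop)
  unfold idleLaplace
  simp_rw [idleProb_succ hlam hmu]
  have h1 : ∀ t, ENNReal.ofReal (Real.exp (-(b * t))) *
      ∫⁻ r, ∫⁻ s, idleProb lam mu n (max (w - r) 0 + s) (t - r) ∂(expMeasure mu) ∂(expMeasure lam) =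
      ∫⁻ r, ENNReal.ofReal (Real.exp (-(b * t))) *
        ∫⁻ s, idleProb lam mu n (max (w - r) 0 + s) (t - r) ∂(expMeasure mu) ∂(expMeasure lam) :=
    fun t => (lintegral_const_mul _ (hm.lintegral_prod_right'.comp measurable_prodMk_left)).symm
  simp_rw [h1]
  have hm1 : Measurable fun p : ℝ × ℝ => ENNReal.ofReal (Real.exp (-(b * p.1))) *
      ∫⁻ s, idleProb lam mu n (max (w - p.2) 0 + s) (p.1 - p.2) ∂(expMeasure mu) :=
    Measurable.mul (by fun_prop) hm.lintegral_prod_right'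
  rw [lintegral_lintegral_swap hm1.aemeasurable]
  refine lintegral_congr fun r => ?_
  -- Restart the clock at the first arrival. Integrating over all of `ℝ` in `idleLaplace` makes this
  -- a plain translation, with no boundary term.
  rw [← lintegral_add_right_eq_self _ r]
  simp only [add_sub_cancel_right]
  have h2 : ∀ t, ENNReal.ofReal (Real.exp (-(b * (t + r)))) = ENNReal.ofReal (Real.exp (-(b * r))) *
      ENNReal.ofReal (Real.exp (-(b * t))) := fun t => by
    rw [← ENNReal.ofReal_mul (Real.exp_pos _).le, ← Real.exp_add]
    ring_nf
  have hm2 : Measurable fun p : ℝ × ℝ => idleProb lam mu n (max (w - r) 0 + p.2) p.1 :=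
    measurable_idleProb_comp hlam hmu n (by fun_prop) (by fun_prop)
  simp_rw [h2, mul_assoc]
  rw [lintegral_const_mul' _ _ ENNReal.ofReal_ne_top]
  congr 1
  have h3 : ∀ t, ENNReal.ofReal (Real.exp (-(b * t))) *
      ∫⁻ s, idleProb lam mu n (max (w - r) 0 + s) t ∂(expMeasure mu) =
      ∫⁻ s, ENNReal.ofReal (Real.exp (-(b * t))) *
        idleProb lam mu n (max (w - r) 0 + s) t ∂(expMeasure mu) :=
    fun t => (lintegral_const_mul _ (hm2.comp measurable_prodMk_left)).symm
  simp_rw [h3]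
  exact lintegral_lintegral_swap (Measurable.aemeasurable (Measurable.mul (by fun_prop) hm2))

lemma lintegral_exp_neg_Ico {c a b : ℝ} (hc : 0 < c) (hab : a ≤ b) :
    ∫⁻ x in Set.Ico a b, ENNReal.ofReal (Real.exp (-(c * x))) =
      ENNReal.ofReal ((Real.exp (-(c * a)) - Real.exp (-(c * b))) / c) := by
  have h := lintegral_exp_neg_Ici hc a
  rw [← Set.Ico_union_Ici_eq_Ici hab, lintegral_union measurableSet_Ici
    (Set.disjoint_left.2 fun x hx hx' => not_le.2 hx.2 hx'), lintegral_exp_neg_Ici hc b] at h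
  rw [sub_div, ENNReal.ofReal_sub _ (by positivity), ← h,
    ENNReal.add_sub_cancel_right ENNReal.ofReal_ne_top]

/-- The exponent of the net input process, with `φ η = η - lam * η / (mu + η)`. -/
noncomputable def laplaceExponent (lam mu eta : ℝ) : ℝ := eta * (mu - lam + eta) / (mu + eta)

lemma laplaceExponent_pos {lam mu eta : ℝ} (hlam : 0 < lam) (hlt : lam < mu) (heta : 0 < eta) :
    0 < laplaceExponent lam mu eta := by
  have : 0 < mu - lam := by linarith
  have : 0 < mu := by linarith
  unfold laplaceExponent
  positivity

/-- The equation at the first arrival solved by `w ↦ exp (-η w) / η`. -/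
lemma exp_renewal {lam mu eta w : ℝ} (hlam : 0 < lam) (hlt : lam < mu) (heta : 0 < eta)
    (hw : 0 ≤ w) :
    ENNReal.ofReal (Real.exp (-(eta * w)) / eta) =
      ENNReal.ofReal (Real.exp (-((lam + laplaceExponent lam mu eta) * w)) /
        (lam + laplaceExponent lam mu eta)) +
      ∫⁻ r, ENNReal.ofReal (Real.exp (-(laplaceExponent lam mu eta * r))) *
        ∫⁻ s, ENNReal.ofReal (Real.exp (-(eta * (max (w - r) 0 + s))) / eta)
          ∂(expMeasure mu) ∂(expMeasure lam) := by
  have hmu : 0 < mu := hlam.trans hlt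
  set b := laplaceExponent lam mu eta with hb
  have hb0 : 0 < b := laplaceExponent_pos hlam hlt heta
  -- This identity is what singles out `b` as the exponent paired with `eta`.
  have hk : lam + b - eta = lam * mu / (mu + eta) := by
    rw [hb, laplaceExponent]
    field_simp
    ring
  have hk0 : 0 < lam + b - eta := by
    rw [hk]
    positivity
  have h1 : ∀ r, ∫⁻ s, ENNReal.ofReal (Real.exp (-(eta * (max (w - r) 0 + s))) / eta)
      ∂(expMeasure mu) =
      ENNReal.ofReal (Real.exp (-(eta * max (w - r) 0)) / eta * (mu / (mu + eta))) := fun r => by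
    rw [ENNReal.ofReal_mul (by positivity), ← lintegral_exp_expMeasure hmu (by linarith),
      ← lintegral_const_mul _ (by fun_prop)]
    refine lintegral_congr fun s => ?_
    rw [← ENNReal.ofReal_mul (by positivity), div_mul_eq_mul_div, ← Real.exp_add]
    ring_nf
  simp_rw [h1]
  rw [lintegral_expMeasure (by fun_prop), ← Set.Ico_union_Ici_eq_Ici hw,
    lintegral_union measurableSet_Ici (Set.disjoint_left.2 fun x hx hx' => not_le.2 hx.2 hx')]
  -- Here the first customer arrives while the initial work is still being served.
  have h2 : ∫⁻ r in Set.Ico 0 w, ENNReal.ofReal (lam * Real.exp (-(lam * r))) *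
      (ENNReal.ofReal (Real.exp (-(b * r))) *
        ENNReal.ofReal (Real.exp (-(eta * max (w - r) 0)) / eta * (mu / (mu + eta)))) =
      ENNReal.ofReal (lam * Real.exp (-(eta * w)) / eta * (mu / (mu + eta)) *
        ((1 - Real.exp (-((lam + b - eta) * w))) / (lam + b - eta))) := by
    have := lintegral_exp_neg_Ico hk0 hw
    rw [mul_zero, neg_zero, Real.exp_zero] at this
    rw [ENNReal.ofReal_mul (by positivity), ← this, ← lintegral_const_mul _ (by fun_prop)]
    refine setLIntegral_congr_fun measurableSet_Ico fun r hr => ?_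
    rw [max_eq_left (by linarith [hr.2]), ← ENNReal.ofReal_mul (by positivity),
      ← ENNReal.ofReal_mul (by positivity), ← ENNReal.ofReal_mul (by positivity)]
    congr 1
    have e : Real.exp (-(lam * r)) * (Real.exp (-(b * r)) * Real.exp (-(eta * (w - r)))) =
        Real.exp (-(eta * w)) * Real.exp (-((lam + b - eta) * r)) := by
      rw [← Real.exp_add, ← Real.exp_add, ← Real.exp_add]
      ring_nf
    linear_combination lam / eta * (mu / (mu + eta)) * e
  -- Here the first customer finds no remaining work.
  have h3 : ∫⁻ r in Set.Ici w, ENNReal.ofReal (lam * Real.exp (-(lam * r))) *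
      (ENNReal.ofReal (Real.exp (-(b * r))) *
        ENNReal.ofReal (Real.exp (-(eta * max (w - r) 0)) / eta * (mu / (mu + eta)))) =
      ENNReal.ofReal (lam / eta * (mu / (mu + eta)) *
        (Real.exp (-((lam + b) * w)) / (lam + b))) := by
    have hlb : 0 < lam + b := by positivity
    rw [ENNReal.ofReal_mul (by positivity), ← lintegral_exp_neg_Ici hlb,
      ← lintegral_const_mul _ (by fun_prop)]
    refine setLIntegral_congr_fun measurableSet_Ici fun r hr => ?_
    have hr' : w - r ≤ 0 := sub_nonpos.2 hr
    rw [max_eq_right hr', ← ENNReal.ofReal_mul (by positivity),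
      ← ENNReal.ofReal_mul (by positivity), ← ENNReal.ofReal_mul (by positivity)]
    congr 1
    have e : Real.exp (-(lam * r)) * Real.exp (-(b * r)) = Real.exp (-((lam + b) * r)) := by
      rw [← Real.exp_add]
      ring_nf
    rw [mul_zero, neg_zero, Real.exp_zero]
    linear_combination lam / eta * (mu / (mu + eta)) * e
  have hle : Real.exp (-((lam + b - eta) * w)) ≤ 1 := Real.exp_le_one_iff.2 (by
    have := mul_nonneg hk0.le hw
    linarith)
  have h4 : 0 ≤ lam * Real.exp (-(eta * w)) / eta * (mu / (mu + eta)) *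
        ((1 - Real.exp (-((lam + b - eta) * w))) / (lam + b - eta)) :=
    mul_nonneg (by positivity) (div_nonneg (by linarith) hk0.le)
  rw [h2, h3, ← ENNReal.ofReal_add h4 (by positivity), ← ENNReal.ofReal_add (by positivity)
    (add_nonneg h4 (by positivity))]
  congr 1
  have e : Real.exp (-((lam + b) * w)) =
      Real.exp (-(eta * w)) * Real.exp (-((lam + b - eta) * w)) := by
    rw [← Real.exp_add]
    ring_nf
  have hc : lam * (mu / (mu + eta)) = lam + b - eta := by rw [hk]; ring
  have hlb : lam + b ≠ 0 := by positivity
  rw [e]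
  have : lam * Real.exp (-(eta * w)) / eta * (mu / (mu + eta)) =
      (lam + b - eta) * (Real.exp (-(eta * w)) / eta) := by rw [← hc]; ring
  rw [this]
  have : lam / eta * (mu / (mu + eta)) = (lam + b - eta) / eta := by rw [← hc]; ring
  rw [this]
  have hk1 := hk0.ne'
  generalize hkd : lam + b - eta = k at hk1 ⊢
  have hkd' : lam + b = k + eta := by linarith
  rw [hkd'] at hlb ⊢
  field_simp
  ring

/-- The partial sums are the iterates, started from zero, of the equation in `exp_renewal`. The
initial error lies between `0` and `1 / eta`, and each iteration multiplies its bound by `lam / (lam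
+ b)`, the Laplace transform at `b` of an interarrival time. -/
lemma sum_idleLaplace_bounds {lam mu eta : ℝ} (hlam : 0 < lam) (hlt : lam < mu) (heta : 0 < eta)
    (n : ℕ) {w : ℝ} (hw : 0 ≤ w) :
    ∑ k ∈ Finset.range n, idleLaplace lam mu (laplaceExponent lam mu eta) k w ≤
        ENNReal.ofReal (Real.exp (-(eta * w)) / eta) ∧
      ENNReal.ofReal (Real.exp (-(eta * w)) / eta) ≤
        ∑ k ∈ Finset.range n, idleLaplace lam mu (laplaceExponent lam mu eta) k w +
          ENNReal.ofReal ((lam / (lam + laplaceExponent lam mu eta)) ^ n / eta) := by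
  have hmu : 0 < mu := hlam.trans hlt
  have := isProbabilityMeasure_expMeasure hlam
  have := isProbabilityMeasure_expMeasure hmu
  have hb0 : 0 < laplaceExponent lam mu eta := laplaceExponent_pos hlam hlt heta
  set b := laplaceExponent lam mu eta with hb
  have hlb : 0 < lam + b := by positivity
  have hm := measurable_idleLaplace hlam hmu b
  induction n generalizing w with
  | zero =>
    refine ⟨by simp, ?_⟩
    simp only [Finset.range_zero, Finset.sum_empty, pow_zero, zero_add]
    gcongr
    exact Real.exp_le_one_iff.2 (by nlinarith)
  | succ n ih =>
    have hrs : Measurable fun p : ℝ × ℝ => max (w - p.1) 0 + p.2 := by fun_prop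
    have hsum : ∑ k ∈ Finset.range (n + 1), idleLaplace lam mu b k w =
        idleLaplace lam mu b 0 w + ∫⁻ r, ENNReal.ofReal (Real.exp (-(b * r))) *
          ∫⁻ s, ∑ k ∈ Finset.range n, idleLaplace lam mu b k (max (w - r) 0 + s)
            ∂(expMeasure mu) ∂(expMeasure lam) := by
      rw [Finset.sum_range_succ', add_comm]
      congr 1
      simp_rw [idleLaplace_succ hlam hmu]
      have hk : ∀ k, Measurable fun r => ENNReal.ofReal (Real.exp (-(b * r))) *
          ∫⁻ s, idleLaplace lam mu b k (max (w - r) 0 + s) ∂(expMeasure mu) := fun k =>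
        Measurable.mul (by fun_prop) ((hm k).comp hrs).lintegral_prod_right'
      rw [← lintegral_finsetSum _ fun k _ => hk k]
      refine lintegral_congr fun r => ?_
      have hks : ∀ k, Measurable fun s => idleLaplace lam mu b k (max (w - r) 0 + s) := fun k =>
        (hm k).comp (by fun_prop)
      rw [lintegral_finsetSum _ fun k _ => hks k, Finset.mul_sum]
    rw [hsum, exp_renewal hlam hlt heta hw, ← hb, idleLaplace_zero hlam hmu hlb hw, add_assoc]
    have hs := ae_expMeasure_nonneg mu
    constructor
    · refine add_le_add le_rfl ?_
      refine lintegral_mono fun r => mul_le_mul_right ?_ _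
      refine lintegral_mono_ae ?_
      filter_upwards [hs] with s hs
      exact (ih (add_nonneg (le_max_right _ _) hs)).1
    · gcongr
      have hc : ENNReal.ofReal ((lam / (lam + b)) ^ (n + 1) / eta) =
          ∫⁻ r, ENNReal.ofReal (Real.exp (-(b * r))) *
            ENNReal.ofReal ((lam / (lam + b)) ^ n / eta) ∂(expMeasure lam) := by
        rw [lintegral_mul_const _ (by fun_prop), lintegral_exp_expMeasure hlam hlb,
          ← ENNReal.ofReal_mul (by positivity), pow_succ']
        ring_nf
      rw [hc, ← lintegral_add_right _ (by fun_prop)]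
      refine lintegral_mono fun r => ?_
      rw [← mul_add]
      refine mul_le_mul_right ?_ _
      -- The constant is written as an integral over `s`, so that the induction hypothesis applies
      -- under the inner integral.
      rw [← mul_one (ENNReal.ofReal ((lam / (lam + b)) ^ n / eta)),
        ← measure_univ (μ := expMeasure mu), ← lintegral_const, ← lintegral_add_right _ (by fun_prop)]
      refine lintegral_mono_ae ?_
      filter_upwards [hs] with s hs
      exact (ih (add_nonneg (le_max_right _ _) hs)).2

lemma tsum_idleLaplace {lam mu eta : ℝ} (hlam : 0 < lam) (hlt : lam < mu) (heta : 0 < eta)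
    {w : ℝ} (hw : 0 ≤ w) :
    ∑' k, idleLaplace lam mu (laplaceExponent lam mu eta) k w =
      ENNReal.ofReal (Real.exp (-(eta * w)) / eta) := by
  have hb0 : 0 < laplaceExponent lam mu eta := laplaceExponent_pos hlam hlt heta
  refine le_antisymm (ENNReal.tsum_le_of_sum_range_le fun n =>
    (sum_idleLaplace_bounds hlam hlt heta n hw).1) ?_
  have h0 : Tendsto (fun n : ℕ =>
      ENNReal.ofReal ((lam / (lam + laplaceExponent lam mu eta)) ^ n / eta)) atTop (nhds 0) := by
    rw [← ENNReal.ofReal_zero, ← zero_div eta]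
    refine ENNReal.tendsto_ofReal (Tendsto.div_const ?_ eta)
    exact tendsto_pow_atTop_nhds_zero_of_lt_one (by positivity)
      ((div_lt_one (by positivity)).2 (by linarith))
  have h1 := h0.const_add (∑' k, idleLaplace lam mu (laplaceExponent lam mu eta) k w)
  rw [add_zero] at h1
  exact ge_of_tendsto' h1 fun n => (sum_idleLaplace_bounds hlam hlt heta n hw).2.trans
    (by gcongr; exact ENNReal.sum_le_tsum _)

/-- The workload is a positive part, hence zero exactly when the work left by the last arrival does
not exceed the time elapsed since. The sum runs over the number of arrivals. -/
lemma workloadLaw_singleton_zero {lam mu : ℝ} (hlam : 0 < lam) (hmu : 0 < mu) (ν : Measure ℝ)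
    [IsProbabilityMeasure ν] {t : ℝ} (ht : 0 ≤ t) :
    workloadLaw lam mu ν t {0} = ∫⁻ w, ∑' n, idleProb lam mu n w t ∂ν := by
  have := isProbabilityMeasure_inputLaw hlam hmu
  have hmeas := measurable_workload t (measurableSet_singleton 0)
  rw [workloadLaw, Measure.map_apply (measurable_workload t) (measurableSet_singleton 0),
    Measure.prod_apply hmeas]
  refine lintegral_congr fun w => ?_
  have hF : ∀ n, MeasurableSet {q : (ℕ → ℝ) × (ℕ → ℝ) |
      workloadAtArrival w q.1 q.2 n ≤ t - arrivalTime q.1 n} := fun n =>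
    measurableSet_le ((measurable_workloadAtArrival n).comp measurable_prodMk_left)
      (measurable_const.sub ((measurable_arrivalTime n).comp measurable_fst))
  rw [← lintegral_indicator_one (measurable_prodMk_left hmeas)]
  have h1 : ∀ q : (ℕ → ℝ) × (ℕ → ℝ), (Prod.mk w ⁻¹' ((fun p : ℝ × (ℕ → ℝ) × (ℕ → ℝ) =>
      workload p.1 p.2.1 p.2.2 t) ⁻¹' {0})).indicator (1 : (ℕ → ℝ) × (ℕ → ℝ) → ℝ≥0∞) q =
      {q : (ℕ → ℝ) × (ℕ → ℝ) | workloadAtArrival w q.1 q.2 (numArrivals q.1 t) ≤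
        t - arrivalTime q.1 (numArrivals q.1 t)}.indicator 1 q := fun q => by
    simp only [Set.indicator, Set.mem_preimage, Set.mem_singleton_iff, workload, max_eq_right_iff,
      sub_nonpos, Set.mem_ofPred_eq]
  simp_rw [h1]
  refine (lintegral_numArrivals hlam hmu ht (F := fun n => {q : (ℕ → ℝ) × (ℕ → ℝ) |
      workloadAtArrival w q.1 q.2 n ≤ t - arrivalTime q.1 n}.indicator 1)
      fun n => measurable_one.indicator (hF n)).trans ?_
  congr 1
  ext n
  rw [idleProb, ← lintegral_indicator_one (measurableSet_idleEvent n w t)]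
  refine lintegral_congr fun q => ?_
  by_cases ha : q.1 ∈ countEvent n t <;>
    by_cases hb : workloadAtArrival w q.1 q.2 n ≤ t - arrivalTime q.1 n <;>
    simp [Set.indicator, idleEvent, ha, hb]

/-- The Laplace transform in time of the probability that the queue is empty. -/
lemma lintegral_exp_mul_workloadLaw_zero {lam mu eta : ℝ} (hlam : 0 < lam) (hlt : lam < mu)
    (heta : 0 < eta) (ν : Measure ℝ) [IsProbabilityMeasure ν] (hν : ν (Set.Iio 0) = 0) :
    ∫⁻ t in Set.Ici 0, ENNReal.ofReal (Real.exp (-(laplaceExponent lam mu eta * t))) *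
        workloadLaw lam mu ν t {0} =
      ∫⁻ w, ENNReal.ofReal (Real.exp (-(eta * w)) / eta) ∂ν := by
  have hmu : 0 < mu := hlam.trans hlt
  set b := laplaceExponent lam mu eta with hb
  -- The idle probabilities vanish at negative times, so the restriction to `t ≥ 0` can be dropped.
  have h1 : ∀ t, (Set.Ici (0 : ℝ)).indicator (fun t => ENNReal.ofReal (Real.exp (-(b * t))) *
      workloadLaw lam mu ν t {0}) t =
      ∫⁻ w, ∑' n, ENNReal.ofReal (Real.exp (-(b * t))) * idleProb lam mu n w t ∂ν := fun t => by
    simp_rw [ENNReal.tsum_mul_left]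
    by_cases ht : 0 ≤ t
    · rw [Set.indicator_of_mem (by exact ht), workloadLaw_singleton_zero hlam hmu ν ht,
        lintegral_const_mul' _ _ ENNReal.ofReal_ne_top]
    · rw [Set.indicator_of_notMem (by exact ht)]
      simp [idleProb_of_neg hlam hmu _ _ (not_le.1 ht)]
  have hm : ∀ n, Measurable fun p : ℝ × ℝ =>
      ENNReal.ofReal (Real.exp (-(b * p.1))) * idleProb lam mu n p.2 p.1 := fun n =>
    Measurable.mul (by fun_prop) (measurable_idleProb_comp hlam hmu n (by fun_prop) (by fun_prop))
  rw [← lintegral_indicator measurableSet_Ici]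
  simp_rw [h1]
  rw [lintegral_lintegral_swap (Measurable.tsum hm).aemeasurable]
  have hae : ∀ᵐ w ∂ν, 0 ≤ w := by
    rw [ae_iff]
    simpa [Set.Iio, not_le] using hν
  refine lintegral_congr_ae ?_
  filter_upwards [hae] with w hw
  have hmw : ∀ n, Measurable fun t => ENNReal.ofReal (Real.exp (-(b * t))) * idleProb lam mu n w t :=
    fun n => (hm n).comp measurable_prodMk_right
  rw [lintegral_tsum fun n => (hmw n).aemeasurable, ← tsum_idleLaplace hlam hlt heta hw]
  rfl

/-! ### Uniqueness of Laplace transforms -/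

/-- A bounded continuous injective function that is equal to `exp (-w)` for `0 ≤ w`. -/
noncomputable def expNegBCF : ℝ →ᵇ ℝ :=
  BoundedContinuousFunction.ofNormedAddCommGroup
    (fun w => Real.exp (-(max w 0)) + (1 - Real.exp (min w 0))) (by fun_prop) 2 fun w => by
      have h1 : Real.exp (-(max w 0)) ≤ 1 := Real.exp_le_one_iff.2 (by simp)
      have h2 : Real.exp (min w 0) ≤ 1 := Real.exp_le_one_iff.2 (by simp)
      have h3 := Real.exp_pos (-(max w 0))
      have h4 := Real.exp_pos (min w 0)
      rw [Real.norm_eq_abs, abs_le]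
      constructor <;> linarith

lemma expNegBCF_apply (w : ℝ) :
    expNegBCF w = Real.exp (-(max w 0)) + (1 - Real.exp (min w 0)) := rfl

lemma expNegBCF_of_nonneg {w : ℝ} (hw : 0 ≤ w) : expNegBCF w = Real.exp (-w) := by
  simp [expNegBCF_apply, hw]

lemma expNegBCF_strictAnti : StrictAnti expNegBCF := by
  intro x y hxy
  simp only [expNegBCF_apply]
  rcases le_total 0 y with hy | hy
  · rcases le_total 0 x with hx | hx
    · simp only [max_eq_left hx, max_eq_left hy, min_eq_right hx, min_eq_right hy]
      gcongr
    · simp only [max_eq_right hx, max_eq_left hy, min_eq_left hx, min_eq_right hy]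
      rcases hx.lt_or_eq with h | h
      · have : Real.exp x < 1 := by simpa using h
        have : Real.exp (-y) ≤ 1 := Real.exp_le_one_iff.2 (by linarith)
        simp only [neg_zero, Real.exp_zero]
        linarith
      · subst h
        simpa using hxy
  · have hx : x ≤ 0 := hxy.le.trans hy
    simp only [max_eq_right hx, max_eq_right hy, min_eq_left hx, min_eq_left hy]
    gcongr

/-- The star subalgebra of polynomials in `expNegBCF`. -/
noncomputable def expNegAlgebra : StarSubalgebra ℝ (ℝ →ᵇ ℝ) where
  toSubalgebra := (Polynomial.aeval (R := ℝ) expNegBCF).range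
  star_mem' := by
    rintro _ ⟨p, rfl⟩
    refine ⟨p, ?_⟩
    ext x
    simp

lemma aeval_expNegBCF_apply (p : Polynomial ℝ) (x : ℝ) :
    Polynomial.aeval expNegBCF p x = p.eval (expNegBCF x) := by
  induction p using Polynomial.induction_on' with
  | add p q hp hq => simp [hp, hq]
  | monomial n a => simp [Polynomial.aeval_monomial, Algebra.algebraMap_eq_smul_one]

/-- A probability measure on `[0, ∞)` is determined by its Laplace transform. -/
lemma ext_of_laplace {P Q : Measure ℝ} [IsProbabilityMeasure P] [IsProbabilityMeasure Q]
    (hP : ∀ᵐ w ∂P, 0 ≤ w) (hQ : ∀ᵐ w ∂Q, 0 ≤ w)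
    (h : ∀ eta : ℝ, 0 < eta →
      ∫ w, Real.exp (-(eta * w)) ∂P = ∫ w, Real.exp (-(eta * w)) ∂Q) : P = Q := by
  have hpow : ∀ n : ℕ, ∫ w, expNegBCF w ^ n ∂P = ∫ w, expNegBCF w ^ n ∂Q := by
    intro n
    have key : ∀ P' : Measure ℝ, (∀ᵐ w ∂P', 0 ≤ w) →
        ∫ w, expNegBCF w ^ n ∂P' = ∫ w, Real.exp (-(n * w)) ∂P' := fun P' hP' => by
      refine integral_congr_ae ?_
      filter_upwards [hP'] with w hw
      rw [expNegBCF_of_nonneg hw, ← Real.exp_nat_mul]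
      ring_nf
    rw [key P hP, key Q hQ]
    rcases Nat.eq_zero_or_pos n with rfl | hn
    · simp
    · exact h n (by exact_mod_cast hn)
  -- A point-separating algebra of bounded continuous functions determines the measure. Injectivity
  -- of `expNegBCF` on all of `ℝ` gives separation, and its powers are the transforms at integers.
  refine ext_of_forall_mem_subalgebra_integral_eq_of_polish (𝕜 := ℝ) (A := expNegAlgebra) ?_ ?_
  · intro x y hxy
    refine ⟨expNegBCF, ⟨BoundedContinuousFunction.toContinuousMapStarₐ ℝ expNegBCF,
      ⟨expNegBCF, ⟨Polynomial.X, by simp⟩, rfl⟩, rfl⟩, expNegBCF_strictAnti.injective.ne hxy⟩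
  · rintro _ ⟨p, rfl⟩
    have hint : ∀ (P' : Measure ℝ) [IsProbabilityMeasure P'] (p : Polynomial ℝ),
        Integrable (fun x => p.eval (expNegBCF x)) P' := fun P' _ p =>
      ((Polynomial.aeval expNegBCF p).integrable P').congr
        (ae_of_all _ fun x => aeval_expNegBCF_apply p x)
    change ∫ x, Polynomial.aeval expNegBCF p x ∂P = ∫ x, Polynomial.aeval expNegBCF p x ∂Q
    simp only [aeval_expNegBCF_apply]
    induction p using Polynomial.induction_on' with
    | add p q hp hq =>
      simp only [Polynomial.eval_add]
      rw [integral_add (hint P p) (hint P q), integral_add (hint Q p) (hint Q q), hp, hq]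
    | monomial n a =>
      simp only [Polynomial.eval_monomial, integral_const_mul, hpow]

/-! ### The stationary distribution -/

lemma IsStationary.ae_nonneg {lam mu : ℝ} {ν : Measure ℝ} (h : IsStationary lam mu ν) :
    ∀ᵐ w ∂ν, 0 ≤ w := by
  rw [ae_iff]
  simpa [Set.Iio, not_le] using h.nonneg

lemma integral_exp_eq_toReal (ν : Measure ℝ) (eta : ℝ) :
    ∫ w, Real.exp (-(eta * w)) ∂ν = (∫⁻ w, ENNReal.ofReal (Real.exp (-(eta * w))) ∂ν).toReal :=
  integral_eq_lintegral_of_nonneg_ae (ae_of_all _ fun _ => (Real.exp_pos _).le)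
    (by fun_prop : Measurable fun w : ℝ => Real.exp (-(eta * w))).aestronglyMeasurable

/-- Under a stationary law the probability of an empty queue is constant in time, so its transform
is `ν {0} / φ(η)`. Comparison with the general formula leaves only the mass at zero unknown. -/
lemma IsStationary.laplace_aux {lam mu eta : ℝ} {ν : Measure ℝ} (h : IsStationary lam mu ν)
    (hlam : 0 < lam) (hlt : lam < mu) (heta : 0 < eta) :
    ∫ w, Real.exp (-(eta * w)) ∂ν = (mu + eta) / (mu - lam + eta) * ν.real {0} := by
  have := h.prob
  have hb := laplaceExponent_pos hlam hlt heta
  have h1 := lintegral_exp_mul_workloadLaw_zero hlam hlt heta ν h.nonneg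
  have h2 : ∫⁻ t in Set.Ici 0, ENNReal.ofReal (Real.exp (-(laplaceExponent lam mu eta * t))) *
      workloadLaw lam mu ν t {0} =
      ENNReal.ofReal (1 / laplaceExponent lam mu eta) * ν {0} := by
    rw [setLIntegral_congr_fun measurableSet_Ici (g := fun t =>
      ENNReal.ofReal (Real.exp (-(laplaceExponent lam mu eta * t))) * ν {0})
      fun t ht => by rw [h.invariant t ht], lintegral_mul_const _ (by fun_prop),
      lintegral_exp_neg_Ici hb]
    simp
  have h3 : ∫⁻ w, ENNReal.ofReal (Real.exp (-(eta * w)) / eta) ∂ν =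
      ENNReal.ofReal (1 / eta) * ∫⁻ w, ENNReal.ofReal (Real.exp (-(eta * w))) ∂ν := by
    rw [← lintegral_const_mul _ (by fun_prop)]
    refine lintegral_congr fun w => ?_
    rw [← ENNReal.ofReal_mul (by positivity)]
    ring_nf
  rw [h2, h3] at h1
  have h4 := congrArg ENNReal.toReal h1
  rw [ENNReal.toReal_mul, ENNReal.toReal_mul, ← integral_exp_eq_toReal,
    ENNReal.toReal_ofReal (by positivity), ENNReal.toReal_ofReal (by positivity)] at h4
  have : 0 < mu - lam + eta := by linarith
  have : 0 < mu + eta := by linarith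
  rw [laplaceExponent] at h4
  change _ * ν.real {0} = _ at h4
  field_simp at h4 ⊢
  linarith

/-- Total mass one fixes the unknown: let `eta = 1 / (n + 1)` tend to zero in `laplace_aux`. -/
lemma IsStationary.real_singleton_zero {lam mu : ℝ} {ν : Measure ℝ} (h : IsStationary lam mu ν)
    (hlam : 0 < lam) (hlt : lam < mu) : ν.real {0} = (mu - lam) / mu := by
  have := h.prob
  have hmu : 0 < mu := hlam.trans hlt
  have h1 : Tendsto (fun n : ℕ => ∫ w, Real.exp (-(1 / ((n : ℝ) + 1) * w)) ∂ν) atTop (nhds 1) := by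
    have h2 : nhds (1 : ℝ) = nhds (∫ _, (1 : ℝ) ∂ν) := by simp
    rw [h2]
    refine tendsto_integral_of_dominated_convergence (fun _ => 1) (fun n => ?_) (by simp)
      (fun n => ?_) ?_
    · exact (by fun_prop : Measurable fun w : ℝ =>
        Real.exp (-(1 / ((n : ℝ) + 1) * w))).aestronglyMeasurable
    · filter_upwards [h.ae_nonneg] with w hw
      rw [Real.norm_eq_abs, Real.abs_exp]
      refine Real.exp_le_one_iff.2 (neg_nonpos.2 ?_)
      positivity
    · refine ae_of_all _ fun w => ?_
      have := ((tendsto_one_div_add_atTop_nhds_zero_nat (𝕜 := ℝ)).mul_const w).neg.rexp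
      simpa using this
  have h2 : Tendsto (fun n : ℕ => (mu + 1 / ((n : ℝ) + 1)) / (mu - lam + 1 / ((n : ℝ) + 1)) *
      ν.real {0}) atTop (nhds ((mu + 0) / (mu - lam + 0) * ν.real {0})) := by
    have h0 := tendsto_one_div_add_atTop_nhds_zero_nat (𝕜 := ℝ)
    exact ((h0.const_add mu).div (h0.const_add (mu - lam)) (by linarith)).mul_const _
  have h3 : ∀ n : ℕ, ∫ w, Real.exp (-(1 / ((n : ℝ) + 1) * w)) ∂ν =
      (mu + 1 / ((n : ℝ) + 1)) / (mu - lam + 1 / ((n : ℝ) + 1)) * ν.real {0} := fun n =>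
    h.laplace_aux hlam hlt (by positivity)
  simp_rw [h3] at h1
  have h4 := tendsto_nhds_unique h1 h2
  have : 0 < mu - lam := by linarith
  rw [add_zero, add_zero] at h4
  field_simp at h4 ⊢
  linarith

/-- The Laplace transform of the stationary distribution. -/
lemma IsStationary.laplace {lam mu eta : ℝ} {ν : Measure ℝ} (h : IsStationary lam mu ν)
    (hlam : 0 < lam) (hlt : lam < mu) (heta : 0 < eta) :
    ∫ w, Real.exp (-(eta * w)) ∂ν = (mu + eta) / (mu - lam + eta) * ((mu - lam) / mu) := by
  rw [h.laplace_aux hlam hlt heta, h.real_singleton_zero hlam hlt]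

/-- The stationary distribution is a mixture of a point mass and an exponential distribution. -/
lemma IsStationary.eq_mixture {lam mu : ℝ} {ν : Measure ℝ} (h : IsStationary lam mu ν)
    (hlam : 0 < lam) (hlt : lam < mu) :
    ν = ENNReal.ofReal ((mu - lam) / mu) • Measure.dirac 0 +
      ENNReal.ofReal (lam / mu) • expMeasure (mu - lam) := by
  have := h.prob
  have hmu : 0 < mu := hlam.trans hlt
  have hd : 0 < mu - lam := by linarith
  have := isProbabilityMeasure_expMeasure hd
  have : IsProbabilityMeasure (ENNReal.ofReal ((mu - lam) / mu) • Measure.dirac (0 : ℝ) +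
      ENNReal.ofReal (lam / mu) • expMeasure (mu - lam)) := ⟨by
    simp only [Measure.coe_add, Measure.coe_smul, Pi.add_apply, Pi.smul_apply, measure_univ,
      smul_eq_mul, mul_one]
    rw [← ENNReal.ofReal_add (by positivity) (by positivity), ← add_div, sub_add_cancel,
      div_self hmu.ne', ENNReal.ofReal_one]⟩
  refine ext_of_laplace h.ae_nonneg ?_ fun eta heta => ?_
  · rw [ae_add_measure_iff]
    refine ⟨Measure.ae_smul_measure ?_ _, Measure.ae_smul_measure (ae_expMeasure_nonneg _) _⟩
    rw [ae_dirac_iff measurableSet_Ici]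
  · rw [h.laplace hlam hlt heta, integral_exp_eq_toReal, lintegral_add_measure,
      lintegral_smul_measure, lintegral_smul_measure, lintegral_dirac,
      lintegral_exp_expMeasure hd (by linarith), smul_eq_mul, smul_eq_mul, mul_zero, neg_zero,
      Real.exp_zero, ENNReal.ofReal_one, mul_one, ← ENNReal.ofReal_mul (by positivity),
      ← ENNReal.ofReal_add (by positivity) (by positivity), ENNReal.toReal_ofReal (by positivity)]
    field_simp
    ring

/-- The exact decay rate of the tail is `mu - lam`; allowing any smaller `th` lets one exponent
serve both `π₀` and `π`. -/
lemma IsStationary.measure_Ioi_le {lam mu th : ℝ} {ν : Measure ℝ} (h : IsStationary lam mu ν)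
    (hlam : 0 < lam) (hlt : lam < mu) (hth0 : 0 ≤ th) (hth : th ≤ mu - lam) (x : ℝ) :
    ν (Set.Ioi x) ≤ ENNReal.ofReal (Real.exp (-(th * x))) := by
  have := h.prob
  have hmu : 0 < mu := hlam.trans hlt
  rcases lt_or_ge x 0 with hx | hx
  · refine prob_le_one.trans (ENNReal.one_le_ofReal.2 (Real.one_le_exp ?_))
    nlinarith
  · rw [h.eq_mixture hlam hlt]
    simp only [Measure.coe_add, Measure.coe_smul, Pi.add_apply, Pi.smul_apply, smul_eq_mul]
    rw [expMeasure_Ioi (by linarith) hx, Measure.dirac_apply' _ measurableSet_Ioi,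
      Set.indicator_of_notMem (by simpa using hx), mul_zero, zero_add,
      ← ENNReal.ofReal_mul (by positivity)]
    refine ENNReal.ofReal_le_ofReal ?_
    calc lam / mu * Real.exp (-((mu - lam) * x)) ≤ 1 * Real.exp (-(th * x)) := by
          gcongr
          exact (div_le_one hmu).2 hlt.le
      _ = _ := one_mul _

/-! ### Upper bound: comparison with the empty queue -/

/-- Translations commute with `max`, so the recursion keeps the unreflected path from `w` as a
separate branch, while truncation at zero is absorbed by the branch started from `0`. -/
lemma workloadAtArrival_eq_max {w : ℝ} (hw : 0 ≤ w) (T S : ℕ → ℝ) (n : ℕ) :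
    workloadAtArrival w T S n = max (workloadAtArrival 0 T S n)
      (w + (∑ i ∈ Finset.range n, S i - arrivalTime T n)) := by
  induction n with
  | zero => simp [workloadAtArrival, arrivalTime, hw]
  | succ n ih =>
    have hA : arrivalTime T (n + 1) = arrivalTime T n + T n := Finset.sum_range_succ _ _
    rw [workloadAtArrival, workloadAtArrival, ih, hA, Finset.sum_range_succ, ← max_sub_sub_right,
      max_right_comm, ← max_add_add_right]
    congr 1
    ring

/-- The reflection formula for the dependence on the initial workload. -/
lemma workload_eq_max {w : ℝ} (hw : 0 ≤ w) (T S : ℕ → ℝ) (t : ℝ) :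
    workload w T S t =
      max (workload 0 T S t) (w + (∑ i ∈ Finset.range (numArrivals T t), S i - t)) := by
  rw [workload, workload, workloadAtArrival_eq_max hw, ← max_sub_sub_right, max_right_comm]
  congr 1
  ring

lemma measurable_netInput (t : ℝ) : Measurable fun q : (ℕ → ℝ) × (ℕ → ℝ) =>
    ∑ i ∈ Finset.range (numArrivals q.1 t), q.2 i - t := by
  have hN : Measurable fun q : (ℕ → ℝ) × (ℕ → ℝ) => numArrivals q.1 t :=
    (measurable_numArrivals t).comp measurable_fst
  have hF : Measurable fun p : ((ℕ → ℝ) × (ℕ → ℝ)) × ℕ => ∑ i ∈ Finset.range p.2, p.1.2 i - t :=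
    measurable_from_prod_countable_left fun n =>
      (by fun_prop : Measurable fun q : (ℕ → ℝ) × (ℕ → ℝ) => ∑ i ∈ Finset.range n, q.2 i - t)
  exact hF.comp (measurable_id.prodMk hN)

lemma isProbabilityMeasure_workloadLaw {lam mu : ℝ} (hlam : 0 < lam) (hmu : 0 < mu)
    (ν : Measure ℝ) [IsProbabilityMeasure ν] (t : ℝ) :
    IsProbabilityMeasure (workloadLaw lam mu ν t) := by
  have := isProbabilityMeasure_inputLaw hlam hmu
  exact Measure.isProbabilityMeasure_map (measurable_workload t).aemeasurable

/-- Comparison with the workload process of an initially empty queue: the two processes agree as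
soon as the initial work has been served. -/
lemma abs_workloadLaw_sub_le {lam mu th t : ℝ} (hlam : 0 < lam) (hmu : 0 < mu) (hth : th < mu)
    (ht : 0 ≤ t) (ν : Measure ℝ) [IsProbabilityMeasure ν] (hν : ∀ᵐ w ∂ν, 0 ≤ w)
    (htail : ∀ x, ν (Set.Ioi x) ≤ ENNReal.ofReal (Real.exp (-(th * x))))
    {A : Set ℝ} (hA : MeasurableSet A) :
    |(workloadLaw lam mu ν t).real A -
        (inputLaw lam mu).real {q | workload 0 q.1 q.2 t ∈ A}| ≤
      Real.exp ((lam * (mu / (mu - th)) - lam - th) * t) := by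
  have := isProbabilityMeasure_inputLaw hlam hmu
  have hm0 : Measurable fun q : (ℕ → ℝ) × (ℕ → ℝ) => workload 0 q.1 q.2 t :=
    (measurable_workload t).comp measurable_prodMk_left
  have hY := measurable_netInput t
  set P := ν.prod (inputLaw lam mu)
  set Y : (ℕ → ℝ) × (ℕ → ℝ) → ℝ := fun q => ∑ i ∈ Finset.range (numArrivals q.1 t), q.2 i - t
  have h1 : (workloadLaw lam mu ν t).real A = P.real {p | workload p.1 p.2.1 p.2.2 t ∈ A} := by
    rw [measureReal_def, workloadLaw, Measure.map_apply (measurable_workload t) hA]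
    rfl
  have h2 : (inputLaw lam mu).real {q | workload 0 q.1 q.2 t ∈ A} =
      P.real {p | workload 0 p.2.1 p.2.2 t ∈ A} := by
    have : {p : ℝ × (ℕ → ℝ) × (ℕ → ℝ) | workload 0 p.2.1 p.2.2 t ∈ A} =
        Set.univ ×ˢ {q | workload 0 q.1 q.2 t ∈ A} := by
      ext
      simp
    rw [this, measureReal_def, measureReal_def, Measure.prod_prod, measure_univ, one_mul]
  have hU : MeasurableSet {p : ℝ × (ℕ → ℝ) × (ℕ → ℝ) | workload p.1 p.2.1 p.2.2 t ∈ A} :=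
    measurable_workload t hA
  have hV : MeasurableSet {p : ℝ × (ℕ → ℝ) × (ℕ → ℝ) | workload 0 p.2.1 p.2.2 t ∈ A} :=
    (hm0.comp measurable_snd) hA
  rw [h1, h2]
  refine (abs_measureReal_sub_le_measureReal_symmDiff hU.nullMeasurableSet
    hV.nullMeasurableSet).trans ?_
  refine ENNReal.toReal_le_of_le_ofReal (Real.exp_pos _).le ?_
  have hB : MeasurableSet {p : ℝ × (ℕ → ℝ) × (ℕ → ℝ) | 0 < p.1 + Y p.2} :=
    measurableSet_lt measurable_const (measurable_fst.add (hY.comp measurable_snd))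
  calc P (symmDiff {p | workload p.1 p.2.1 p.2.2 t ∈ A} {p | workload 0 p.2.1 p.2.2 t ∈ A})
      ≤ P {p | 0 < p.1 + Y p.2} := by
        refine measure_mono_ae ?_
        have hw : ∀ᵐ p ∂P, 0 ≤ p.1 := Measure.quasiMeasurePreserving_fst.ae hν
        filter_upwards [hw] with p hp hs
        by_contra hn
        have hn' : p.1 + Y p.2 ≤ 0 := not_lt.1 hn
        -- The branch carrying the initial work is nonpositive, hence dominated by the nonnegative
        -- workload of the empty queue.
        have : workload p.1 p.2.1 p.2.2 t = workload 0 p.2.1 p.2.2 t := by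
          rw [workload_eq_max hp, max_eq_left]
          exact hn'.trans (le_max_right _ _)
        rcases hs with ⟨h, h'⟩ | ⟨h, h'⟩
        · exact h' (by simpa only [Set.mem_ofPred_eq, this] using h)
        · exact h' (by simpa only [Set.mem_ofPred_eq, this] using h)
    _ = ∫⁻ q, ν (Set.Ioi (-Y q)) ∂(inputLaw lam mu) := by
        rw [Measure.prod_apply_symm hB]
        refine lintegral_congr fun q => ?_
        congr 1
        ext w
        simp only [Set.mem_preimage, Set.mem_ofPred_eq, Set.mem_Ioi]
        constructor <;> intro h <;> linarith
    _ ≤ ∫⁻ q, ENNReal.ofReal (Real.exp (th * Y q)) ∂(inputLaw lam mu) := by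
        refine lintegral_mono fun q => (htail _).trans (le_of_eq ?_)
        rw [mul_neg, neg_neg]
    _ = _ := lintegral_exp_netInput hlam hmu hth ht

lemma sqrt_mul_lt {lam mu : ℝ} (hlam : 0 < lam) (hlt : lam < mu) : √(lam * mu) < mu := by
  have hmu : 0 < mu := hlam.trans hlt
  rw [Real.sqrt_lt' hmu]
  nlinarith

lemma lt_sqrt_mul {lam mu : ℝ} (hlam : 0 < lam) (hlt : lam < mu) : lam < √(lam * mu) := by
  rw [Real.lt_sqrt hlam.le]
  nlinarith

lemma sq_sqrt_sub_sqrt {lam mu : ℝ} (hlam : 0 < lam) (hmu : 0 < mu) :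
    (√mu - √lam) ^ 2 = lam + mu - 2 * √(lam * mu) := by
  rw [sub_sq, Real.sq_sqrt hmu.le, Real.sq_sqrt hlam.le, Real.sqrt_mul hlam.le]
  ring

/-- The exponential upper bound for the distance to stationarity. -/
lemma tvDist_workloadLaw_le {lam₀ lam mu t : ℝ} (hlam₀ : 0 < lam₀) (hlam : 0 < lam)
    (hlt : lam < mu) (hle : lam₀ ≤ √(lam * mu)) {π₀ π : Measure ℝ}
    (hπ₀ : IsStationary lam₀ mu π₀) (hπ : IsStationary lam mu π) (ht : 0 ≤ t) :
    tvDist (workloadLaw lam mu π₀ t) π ≤ 2 * Real.exp (-(√mu - √lam) ^ 2 * t) := by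
  have hmu : 0 < mu := hlam.trans hlt
  have := hπ₀.prob
  have := hπ.prob
  have h1 := sqrt_mul_lt hlam hlt
  have h2 := lt_sqrt_mul hlam hlt
  have hs0 : 0 < √(lam * mu) := hlam.trans h2
  -- The choice `th = mu - √(lam * mu)` minimises the exponent of the net input.
  have hexp : lam * (mu / (mu - (mu - √(lam * mu)))) - lam - (mu - √(lam * mu)) =
      -(√mu - √lam) ^ 2 := by
    rw [sq_sqrt_sub_sqrt hlam hmu, sub_sub_cancel, ← mul_div_assoc]
    have : lam * mu / √(lam * mu) = √(lam * mu) := Real.div_sqrt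
    rw [this]
    ring
  have : Nonempty {A : Set ℝ // MeasurableSet A} := ⟨⟨∅, .empty⟩⟩
  refine ciSup_le fun A => ?_
  have e0 := abs_workloadLaw_sub_le hlam hmu (th := mu - √(lam * mu)) (by linarith) ht π₀
    hπ₀.ae_nonneg (hπ₀.measure_Ioi_le hlam₀ (hle.trans_lt h1) (by linarith) (by linarith)) A.2
  have e1 := abs_workloadLaw_sub_le hlam hmu (th := mu - √(lam * mu)) (by linarith) ht π
    hπ.ae_nonneg (hπ.measure_Ioi_le hlam hlt (by linarith) (by linarith)) A.2
  rw [hexp] at e0 e1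
  rw [hπ.invariant t ht] at e1
  rw [abs_sub_comm] at e1
  have := abs_sub_le ((workloadLaw lam mu π₀ t).real A)
    ((inputLaw lam mu).real {q | workload 0 q.1 q.2 t ∈ A.1}) (π.real A)
  linarith

/-! ### Lower bound: analytic continuation of the Laplace transform -/

lemma integral_exp_neg_Ici {c : ℝ} (hc : 0 < c) :
    ∫ t in Set.Ici (0 : ℝ), Real.exp (-(c * t)) = 1 / c := by
  rw [integral_eq_lintegral_of_nonneg_ae (ae_of_all _ fun _ => (Real.exp_pos _).le)
    (by fun_prop : Measurable fun t : ℝ => Real.exp (-(c * t))).aestronglyMeasurable,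
    lintegral_exp_neg_Ici hc, ENNReal.toReal_ofReal (by positivity)]
  simp

lemma integrableOn_exp_neg_Ici {c : ℝ} (hc : 0 < c) :
    IntegrableOn (fun t => Real.exp (-(c * t))) (Set.Ici (0 : ℝ)) := by
  rw [integrableOn_Ici_iff_integrableOn_Ioi]
  simpa only [neg_mul] using integrableOn_exp_mul_Ioi (a := -c) (by linarith) 0

lemma integrableOn_exp_mul_of_abs_le {d : ℝ → ℝ} (hd : Measurable d) {a b C : ℝ}
    (hle : ∀ t, 0 ≤ t → |d t| ≤ C * Real.exp (-(a * t))) (hb : -a < b) :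
    IntegrableOn (fun t => Real.exp (-(b * t)) * d t) (Set.Ici 0) := by
  have hm : Measurable fun t => Real.exp (-(b * t)) * d t := Measurable.mul (by fun_prop) hd
  refine Integrable.mono' ((integrableOn_exp_neg_Ici (c := a + b) (by linarith)).const_mul C)
    hm.aestronglyMeasurable ((ae_restrict_mem measurableSet_Ici).mono fun t ht => ?_)
  rw [norm_mul, Real.norm_eq_abs, Real.norm_eq_abs, Real.abs_exp]
  calc Real.exp (-(b * t)) * |d t| ≤ Real.exp (-(b * t)) * (C * Real.exp (-(a * t))) := by
        gcongr
        exact hle t ht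
    _ = C * Real.exp (-((a + b) * t)) := by
        rw [mul_left_comm, ← Real.exp_add]
        ring_nf

/-- The Laplace transform of an exponentially decaying function is analytic. -/
lemma analyticOnNhd_laplace {d : ℝ → ℝ} (hd : Measurable d) {a C : ℝ}
    (hle : ∀ t, 0 ≤ t → |d t| ≤ C * Real.exp (-(a * t))) :
    AnalyticOnNhd ℝ (fun b => ∫ t in Set.Ici 0, Real.exp (-(b * t)) * d t) (Set.Ioi (-a)) := by
  -- Adding the bound makes `d` nonnegative, hence a density. Its Laplace transform is a moment
  -- generating function, analytic in the interior of its domain; the added term contributes `C / (a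
  -- + b)`, which is subtracted again.
  set f : ℝ → ℝ := fun t => d t + C * Real.exp (-(a * t)) with hf
  have hfm : Measurable f := hd.add (by fun_prop)
  have hf0 : ∀ t, 0 ≤ t → 0 ≤ f t := fun t ht => by
    have := (abs_le.1 (hle t ht)).1
    simp only [hf]
    linarith
  set m := (volume.restrict (Set.Ici (0 : ℝ))).withDensity fun t => ENNReal.ofReal (f t) with hm
  have hsmul : ∀ b, (fun t => (ENNReal.ofReal (f t)).toReal • Real.exp (b * -t)) =ᵐ[
      volume.restrict (Set.Ici (0 : ℝ))] fun t =>
        Real.exp (-(b * t)) * d t + C * Real.exp (-((a + b) * t)) := fun b => by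
    filter_upwards [ae_restrict_mem measurableSet_Ici] with t ht
    rw [ENNReal.toReal_ofReal (hf0 t ht), smul_eq_mul, mul_neg]
    have : Real.exp (-((a + b) * t)) = Real.exp (-(a * t)) * Real.exp (-(b * t)) := by
      rw [← Real.exp_add]
      ring_nf
    rw [this]
    ring
  have hi1 : ∀ b, -a < b → IntegrableOn (fun t => Real.exp (-(b * t)) * d t) (Set.Ici 0) :=
    fun b hb => integrableOn_exp_mul_of_abs_le hd hle hb
  have hi2 : ∀ b, -a < b →
      IntegrableOn (fun t => C * Real.exp (-((a + b) * t))) (Set.Ici (0 : ℝ)) :=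
    fun b hb => (integrableOn_exp_neg_Ici (by linarith)).const_mul C
  have hset : Set.Ioi (-a) ⊆ interior (integrableExpSet (fun t : ℝ => -t) m) := by
    refine interior_maximal (fun b hb => ?_) isOpen_Ioi
    change Integrable (fun t : ℝ => Real.exp (b * -t)) m
    rw [hm, integrable_withDensity_iff_integrable_smul' hfm.ennreal_ofReal
      (ae_of_all _ fun _ => ENNReal.ofReal_lt_top), integrable_congr (hsmul b)]
    exact (hi1 b hb).add (hi2 b hb)
  have hmgf : Set.EqOn (fun b => mgf (fun t : ℝ => -t) m b - C * (1 / (a + b)))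
      (fun b => ∫ t in Set.Ici 0, Real.exp (-(b * t)) * d t) (Set.Ioi (-a)) := fun b hb => by
    have hab : 0 < a + b := by
      have : -a < b := hb
      linarith
    simp only [mgf]
    rw [hm, integral_withDensity_eq_integral_toReal_smul hfm.ennreal_ofReal
      (ae_of_all _ fun _ => ENNReal.ofReal_lt_top), integral_congr_ae (hsmul b),
      integral_add (hi1 b hb) (hi2 b hb), integral_const_mul, integral_exp_neg_Ici hab,
      add_sub_cancel_right]
  refine AnalyticOnNhd.congr isOpen_Ioi (fun b hb => ?_) hmgf
  have hab : a + b ≠ 0 := by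
    have : -a < b := hb
    linarith
  exact (analyticAt_mgf (hset hb)).sub
    (analyticAt_const.mul (analyticAt_const.div (analyticAt_const.add analyticAt_id) hab))

/-- The probability of an empty queue cannot converge at a rate beyond the branch point of its
Laplace transform. -/
lemma not_abs_idle_sub_le {lam₀ lam mu a C : ℝ} (hlam₀ : 0 < lam₀) (hlam : 0 < lam)
    (hlt₀ : lam₀ < mu) (hlt : lam < mu) (hne : lam₀ ≠ lam) {π₀ : Measure ℝ}
    (hπ₀ : IsStationary lam₀ mu π₀) (ha : (√mu - √lam) ^ 2 < a) :
    ¬ ∀ t, 0 ≤ t → |(workloadLaw lam mu π₀ t).real {0} - (mu - lam) / mu| ≤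
      C * Real.exp (-(a * t)) := by
  intro hle
  have hmu : 0 < mu := hlam.trans hlt
  have := hπ₀.prob
  have hpm : Measurable fun t => ∫⁻ w, ∑' n, idleProb lam mu n w t ∂π₀ := by
    have : Measurable fun p : ℝ × ℝ => ∑' n, idleProb lam mu n p.2 p.1 :=
      Measurable.tsum fun n => measurable_idleProb_comp hlam hmu n (by fun_prop) (by fun_prop)
    exact this.lintegral_prod_right'
  -- The series form makes measurability in `t` evident; it is the probability of an empty queue for
  -- `t ≥ 0`.
  set p : ℝ → ℝ := fun t => (∫⁻ w, ∑' n, idleProb lam mu n w t ∂π₀).toReal with hp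
  have hp_eq : ∀ t, 0 ≤ t → p t = (workloadLaw lam mu π₀ t).real {0} := fun t ht => by
    rw [measureReal_def, workloadLaw_singleton_zero hlam hmu π₀ ht]
  -- Boundedness phrased as decay at rate `0`, to obtain integrability for every `b > 0`.
  have hp01 : ∀ t, 0 ≤ t → |p t| ≤ 1 * Real.exp (-(0 * t)) := fun t ht => by
    have := isProbabilityMeasure_workloadLaw hlam hmu π₀ t
    rw [hp_eq t ht, abs_of_nonneg measureReal_nonneg]
    simp
  have hpM : Measurable p := hpm.ennreal_toReal
  have hdM : Measurable fun t => p t - (mu - lam) / mu := hpM.sub_const _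
  set F : ℝ → ℝ := fun b => ∫ t in Set.Ici 0, Real.exp (-(b * t)) * (p t - (mu - lam) / mu) with hF
  have hFa : AnalyticOnNhd ℝ F (Set.Ioi (-a)) := analyticOnNhd_laplace hdM (C := C) fun t ht => by
    rw [hp_eq t ht]
    exact hle t ht
  have hFeq : ∀ eta, 0 < eta → F (laplaceExponent lam mu eta) =
      (mu + eta) / (mu - lam₀ + eta) * ((mu - lam₀) / mu) / eta -
        (mu - lam) / mu * (1 / laplaceExponent lam mu eta) := fun eta heta => by
    have hb := laplaceExponent_pos hlam hlt heta
    set b := laplaceExponent lam mu eta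
    have h1 := lintegral_exp_mul_workloadLaw_zero hlam hlt heta π₀ hπ₀.nonneg
    have hbp : Measurable fun t => Real.exp (-(b * t)) * p t := Measurable.mul (by fun_prop) hpM
    have h2 : ∫ t in Set.Ici 0, Real.exp (-(b * t)) * p t =
        (mu + eta) / (mu - lam₀ + eta) * ((mu - lam₀) / mu) / eta := by
      rw [← hπ₀.laplace hlam₀ hlt₀ heta, ← integral_div,
        integral_eq_lintegral_of_nonneg_ae (ae_of_all _ fun _ =>
          mul_nonneg (Real.exp_pos _).le ENNReal.toReal_nonneg) hbp.aestronglyMeasurable,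
        integral_eq_lintegral_of_nonneg_ae (ae_of_all _ fun _ => by positivity)
        (by fun_prop : Measurable fun w => Real.exp (-(eta * w)) / eta).aestronglyMeasurable, ← h1]
      congr 1
      refine setLIntegral_congr_fun measurableSet_Ici fun t ht => ?_
      have := isProbabilityMeasure_workloadLaw hlam hmu π₀ t
      rw [ENNReal.ofReal_mul (Real.exp_pos _).le]
      rw [← workloadLaw_singleton_zero hlam hmu π₀ ht, ENNReal.ofReal_toReal (measure_ne_top _ _)]
    simp only [hF, mul_sub]
    rw [integral_sub (integrableOn_exp_mul_of_abs_le hpM hp01 (by simpa using hb))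
      ((integrableOn_exp_neg_Ici hb).mul_const _), h2, integral_mul_const,
      integral_exp_neg_Ici hb, mul_comm (1 / b)]
  -- In the variable `x = mu + eta` the formula for `F` is rational; `G` is that identity with
  -- denominators cleared, so that it stays meaningful at `x = lam`.
  set G : ℝ → ℝ := fun x => F (x + lam * mu / x - mu - lam) * (mu * (x - lam₀) * (x - lam)) -
    (lam - lam₀) * x with hG
  have hGa : AnalyticOnNhd ℝ G (Set.Ioi 0) := fun x hx => by
    have hx0 : 0 < x := hx
    have hmem : x + lam * mu / x - mu - lam ∈ Set.Ioi (-a) := by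
      -- For every `x > 0` the argument of `F` is at least `-(√mu - √lam) ^ 2`, which exceeds `-a`.
      have h1 : x + lam * mu / x - mu - lam + (√mu - √lam) ^ 2 = (x - √(lam * mu)) ^ 2 / x := by
        have h2 : √(lam * mu) ^ 2 = lam * mu := Real.sq_sqrt (by positivity)
        rw [sq_sqrt_sub_sqrt hlam hmu, sub_sq, h2]
        field_simp
        ring
      have h3 : 0 ≤ (x - √(lam * mu)) ^ 2 / x := by positivity
      rw [Set.mem_Ioi]
      linarith
    have hg : AnalyticAt ℝ (fun x => x + lam * mu / x - mu - lam) x :=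
      ((analyticAt_id.add (analyticAt_const.div analyticAt_id hx0.ne')).sub
        analyticAt_const).sub analyticAt_const
    have hFg : AnalyticAt ℝ (fun x => F (x + lam * mu / x - mu - lam)) x :=
      AnalyticAt.fun_comp (f := fun x => x + lam * mu / x - mu - lam) (hFa _ hmem) hg
    refine (hFg.mul ?_).sub ?_ <;> fun_prop
  have hG0 : ∀ x, mu < x → G x = 0 := fun x hx => by
    have heta : 0 < x - mu := by linarith
    have hx0 : 0 < x := hmu.trans hx
    have hb : laplaceExponent lam mu (x - mu) = x + lam * mu / x - mu - lam := by
      rw [laplaceExponent, show mu + (x - mu) = x by ring]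
      field_simp
      ring
    have hpos := laplaceExponent_pos hlam hlt heta
    have h1 : mu - lam₀ + (x - mu) = x - lam₀ := by ring
    have h2 : x - lam₀ ≠ 0 := by linarith
    have h3 : x - lam ≠ 0 := by linarith
    simp only [hG]
    rw [← hb, hFeq _ heta, h1, show mu + (x - mu) = x by ring, laplaceExponent,
      show mu + (x - mu) = x by ring, show mu - lam + (x - mu) = x - lam by ring]
    have h4 := heta.ne'
    field_simp
    ring
  have hev : G =ᶠ[nhds (mu + 1)] 0 := by
    filter_upwards [Ioi_mem_nhds (lt_add_one mu)] with x hx using hG0 x hx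
  -- Evaluate the continued identity at `x = lam`: the term with `F` drops out, leaving `(lam -
  -- lam₀) * lam = 0`.
  have hz := hGa.eqOn_zero_of_preconnected_of_eventuallyEq_zero isPreconnected_Ioi
    (show mu + 1 ∈ Set.Ioi 0 by exact add_pos hmu one_pos) hev (show lam ∈ Set.Ioi 0 from hlam)
  simp only [hG, sub_self, mul_zero, zero_sub, Pi.zero_apply, neg_eq_zero, mul_eq_zero,
    sub_eq_zero, hlam.ne', or_false] at hz
  exact hne hz.symm

/-! ### Passage to total variation -/

lemma abs_real_sub_real_le_one {P Q : Measure ℝ} [IsProbabilityMeasure P] [IsProbabilityMeasure Q]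
    (A : Set ℝ) : |P.real A - Q.real A| ≤ 1 := by
  have h1 := measureReal_le_one (μ := P) (s := A)
  have h2 := measureReal_le_one (μ := Q) (s := A)
  have h3 := measureReal_nonneg (μ := P) (s := A)
  have h4 := measureReal_nonneg (μ := Q) (s := A)
  rw [abs_le]
  constructor <;> linarith

lemma abs_real_sub_real_le_tvDist {P Q : Measure ℝ} [IsProbabilityMeasure P]
    [IsProbabilityMeasure Q] {A : Set ℝ} (hA : MeasurableSet A) :
    |P.real A - Q.real A| ≤ tvDist P Q :=
  le_ciSup (f := fun A : {A : Set ℝ // MeasurableSet A} => |P.real A.1 - Q.real A.1|)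
    ⟨1, by rintro _ ⟨B, rfl⟩; exact abs_real_sub_real_le_one B.1⟩ ⟨A, hA⟩

lemma tvDist_nonneg {P Q : Measure ℝ} [IsProbabilityMeasure P] [IsProbabilityMeasure Q] :
    0 ≤ tvDist P Q :=
  (abs_nonneg _).trans (abs_real_sub_real_le_tvDist (P := P) (Q := Q) MeasurableSet.empty)

lemma tvDist_le_one {P Q : Measure ℝ} [IsProbabilityMeasure P] [IsProbabilityMeasure Q] :
    tvDist P Q ≤ 1 := by
  have : Nonempty {A : Set ℝ // MeasurableSet A} := ⟨⟨∅, .empty⟩⟩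
  exact ciSup_le fun A => abs_real_sub_real_le_one A.1

/-- The distance dominates the discrepancy on `{0}`, which already cannot decay this fast. -/
lemma not_tvDist_workloadLaw_le {lam₀ lam mu a C : ℝ} (hlam₀ : 0 < lam₀) (hlam : 0 < lam)
    (hlt₀ : lam₀ < mu) (hlt : lam < mu) (hne : lam₀ ≠ lam) {π₀ π : Measure ℝ}
    (hπ₀ : IsStationary lam₀ mu π₀) (hπ : IsStationary lam mu π) (ha : (√mu - √lam) ^ 2 < a) :
    ¬ ∀ t, 0 ≤ t → tvDist (workloadLaw lam mu π₀ t) π ≤ C * Real.exp (-a * t) := by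
  intro h
  have := hπ₀.prob
  have := hπ.prob
  refine not_abs_idle_sub_le (C := C) hlam₀ hlam hlt₀ hlt hne hπ₀ ha fun t ht => ?_
  have := isProbabilityMeasure_workloadLaw hlam (hlam.trans hlt) π₀ t
  rw [← hπ.real_singleton_zero hlam hlt, ← neg_mul]
  exact (abs_real_sub_real_le_tvDist (measurableSet_singleton 0)).trans (h t ht)

end MM1

/-- Let `0 < lam < mu`, let `0 < lam₀ ≤ √(lam * mu)` with `lam₀ ≠ lam`, and let `π₀`, `π` be the
stationary distributions of the M/M/1 workload process with arrival rates `lam₀`, `lam` and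
service rate `mu`. For the process with arrival rate `lam` started from `π₀`, no exponential rate
of convergence to `π` in total variation exceeds `(√mu - √lam)²`, in the strong sense of an
infinite limsup, and that rate is attained: it is the best rate. -/
theorem mainTheorem6 (lam₀ lam mu : ℝ) (hlam₀ : 0 < lam₀) (hlam : 0 < lam) (hlt : lam < mu)
    (hle : lam₀ ≤ Real.sqrt (lam * mu)) (hne : lam₀ ≠ lam)
    (π₀ π : MeasureTheory.Measure ℝ)
    (hπ₀ : MM1.IsStationary lam₀ mu π₀) (hπ : MM1.IsStationary lam mu π) :
    (∀ α : ℝ, (Real.sqrt mu - Real.sqrt lam) ^ 2 < α →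
      Filter.limsup
        (fun t : ℝ => ENNReal.ofReal
          (Real.exp (α * t) * MM1.tvDist (MM1.workloadLaw lam mu π₀ t) π)) Filter.atTop = ⊤) ∧
    IsGreatest
      {α : ℝ | ∃ C : ℝ, ∀ t : ℝ, 0 ≤ t →
        MM1.tvDist (MM1.workloadLaw lam mu π₀ t) π ≤ C * Real.exp (-α * t)}
      ((Real.sqrt mu - Real.sqrt lam) ^ 2) := by
  have hmu : 0 < mu := hlam.trans hlt
  have hlt₀ : lam₀ < mu := hle.trans_lt (MM1.sqrt_mul_lt hlam hlt)
  have := hπ₀.prob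
  have := hπ.prob
  refine ⟨fun α hα => ?_, ⟨2, fun t ht =>
    MM1.tvDist_workloadLaw_le hlam₀ hlam hlt hle hπ₀ hπ ht⟩, ?_⟩
  · by_contra hfin
    obtain ⟨K, hK1, hK2⟩ := exists_between (lt_top_iff_ne_top.2 hfin)
    obtain ⟨t₀, ht₀⟩ := eventually_atTop.1 (eventually_lt_of_limsup_lt hK1)
    -- A finite limsup bounds the distance only from `t₀` on. The second entry of the `max` covers
    -- `t ≤ t₀`, where the distance is at most one.
    refine MM1.not_tvDist_workloadLaw_le (C := max K.toReal (Real.exp (α * t₀))) hlam₀ hlam hlt₀ hlt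
      hne hπ₀ hπ hα fun t ht => ?_
    have := MM1.isProbabilityMeasure_workloadLaw hlam hmu π₀ t
    have hα0 : 0 ≤ α := (sq_nonneg _).trans hα.le
    rw [neg_mul, Real.exp_neg, ← div_eq_mul_inv, le_div_iff₀ (Real.exp_pos _), mul_comm]
    rcases le_total t₀ t with h | h
    · refine le_max_of_le_left ?_
      have h1 := ENNReal.toReal_mono hK2.ne (ht₀ t h).le
      rwa [ENNReal.toReal_ofReal (mul_nonneg (Real.exp_pos _).le MM1.tvDist_nonneg)] at h1
    · refine le_max_of_le_right ?_
      calc Real.exp (α * t) * MM1.tvDist (MM1.workloadLaw lam mu π₀ t) π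
          ≤ Real.exp (α * t₀) * 1 := by
            gcongr
            · exact MM1.tvDist_nonneg
            · exact MM1.tvDist_le_one
        _ = _ := mul_one _
  · rintro α ⟨C, hC⟩
    by_contra! hα
    exact MM1.not_tvDist_workloadLaw_le hlam₀ hlam hlt₀ hlt hne hπ₀ hπ hα hC
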